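/- Conventions. An extension-closed pseudovariety of finite groups is an isomorphism-invariant class $\mathcal C$ of finite groups that contains the trivial group and is closed under subgroups, finite direct products, quotients and extensions. For a group $G$ let $\mathcal N_{\mathcal C}(G)$ be the set of normal subgroups $N\trianglelefteq G$ with $G/N\in\mathcal C$, and let $\pi_N\colon G\to G/N$ be the projection. A subset $X\subseteq G$ is $\mathcal C$-separable if for every $g\in G\setminus X$ there is $N\in\mathcal N_{\mathcal C}(G)$ with $\pi_N(g)\notin\pi_N(X)$; the least index $[G:N]$ of such an $N$ is denoted $D_{G,\mathcal C}(X,g)$. The group $G$ is $\mathcal C$-conjugacy separable (respectively $\mathcal C$-cyclic subgroup separable) if every conjugacy class $g^G$ (respectively every cyclic subgroup $\langle g\rangle$) is $\mathcal C$-separable. Let $G$ be generated by a finite set $S$, with word length $\|\cdot\|_S$. Put $$\mathrm{Conj}_{G,\mathcal C}(n)=\max\{D_{G,\mathcal C}(g^G,h): h\notin g^G,\ \|g\|_S,\|h\|_S\le n\},$$ $$\mathrm{Cyclic}_{G,\mathcal C}(n)=\max\{D_{G,\mathcal C}(\langle g\rangle,h): h\notin\langle g\rangle,\ \|g\|_S,\|h\|_S\le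 n\},$$ where the maximum of the empty set is $1$. Let $\mathrm{RG}_{G,\mathcal C}(n)$ be the least index of an $N\in\mathcal N_{\mathcal C}(G)$ such that $\pi_N$ is injective on the ball of radius $n$ around $1$, and let $$\mathrm{Short}_G(n)=\max\{\min\{\|x\|_S: x^{-1}gx=h\}: g\sim_G h,\ \|g\|_S,\|h\|_S\le n\}.$$ For $f,g\colon\mathbb N\to\mathbb N$ write $f\preceq g$ if there is $K\in\mathbb N$ with $f(n)\le K\,g(Kn)$ for all $n\in\mathbb N$, where $0\in\mathbb N$. Let $A\wr B=\left(\bigoplus_{b\in B}A\right)\rtimes B$ be the restricted wreath product. Theorem. Let $\mathcal C$ be an extension-closed pseudovariety of finite groups and let $A$, $B$ be $\mathcal C$-conjugacy separable groups. 1. If $A$ is nontrivial, then $A\wr B$ is $\mathcal C$-conjugacy separable if and only if $B\in\mathcal C$, or $A$ is abelian and $B$ is $\mathcal C$-cyclic subgroup separable. The following bounds hold for every choice of finite generating sets of $A$, $B$ and $A\wr B$, the functions of one group being all taken with respect to the same generating set of that group. 2. If $B\in\mathcal C$ and $A$ is finitely generated, then $$\mathrm{Conj}_{A\wr B,\mathcal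 C}(n)\preceq\left(\mathrm{Conj}_{A,\mathcal C}(n)\right)^{|B|^3}.$$ Let $\Phi(n)=\mathrm{Short}_B(n)+n$ and $\Psi(n)=\mathrm{RG}_{B,\mathcal C}(\Phi(n))\cdot\mathrm{Cyclic}_{B,\mathcal C}(\Phi(n))^{\Phi(n)^2}$. 3. If $A$ is an infinite, finitely generated abelian group and $B$ is finitely generated and $\mathcal C$-cyclic subgroup separable, then $$\mathrm{Conj}_{A\wr B,\mathcal C}(n)\preceq\max\left\{\mathrm{Conj}_{B,\mathcal C}(n),\ \left(\Psi(n)\cdot\mathrm{Conj}_{A,\mathcal C}(\Psi(n)\cdot n)\right)^{\Psi(n)^3}\right\}.$$ 4. If $A$ is a finite abelian group and $B$ is finitely generated and $\mathcal C$-cyclic subgroup separable, then $$\mathrm{Conj}_{A\wr B,\mathcal C}(n)\preceq\max\left\{\mathrm{Conj}_{B,\mathcal C}(n),\ \Psi(n)\cdot 2^{\Psi(n)}\right\}.$$ -/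

import Mathlib

universe u

/-- A class of groups (in a fixed universe). -/
abbrev GroupClass : Type (u + 1) := (G : Type u) → [Group G] → Prop

/-- Extension-closed pseudovarieties of finite groups: isomorphism-invariant classes of finite
groups closed under subgroups, finite direct products (the empty product, i.e. the trivial group,
included), quotients and extensions. -/
structure IsExtensionClosedPseudovariety (C : GroupClass.{u}) : Prop where
  finite : ∀ (G : Type u) [Group G], C G → Finite G
  iso : ∀ (G H : Type u) [Group G] [Group H], (G ≃* H) → C G → C H
  trivial : C PUnit.{u + 1}
  prod : ∀ (G H : Type u) [Group G] [Group H], C G → C H → C (G × H)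
  subgroup : ∀ (G : Type u) [Group G] (H : Subgroup G), C G → C H
  quotient : ∀ (G : Type u) [Group G] (N : Subgroup G) [N.Normal], C G → C (G ⧸ N)
  extension : ∀ (G : Type u) [Group G] (N : Subgroup G) [N.Normal], C N → C (G ⧸ N) → C G

section Separability

variable (C : GroupClass.{u}) {G : Type u} [Group G]

/-- `N` is a co-`C` subgroup: `N` is normal in `G` and `G / N` belongs to `C`. -/
def IsCoClass (N : Subgroup G) : Prop := ∃ _ : N.Normal, C (G ⧸ N)

/-- The image of `g` in `G / N` does not lie in the image of `X`. -/
def SeparatedBy (N : Subgroup G) (X : Set G) (g : G) : Prop :=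
  (QuotientGroup.mk g : G ⧸ N) ∉ (QuotientGroup.mk : G → G ⧸ N) '' X

/-- `X` is `C`-separable in `G`, i.e. closed in the pro-`C` topology. -/
def IsClassSeparable (X : Set G) : Prop :=
  ∀ g : G, g ∉ X → ∃ N : Subgroup G, IsCoClass C N ∧ SeparatedBy N X g

variable (G) in
/-- `G` is `C`-conjugacy separable: every conjugacy class is `C`-separable. -/
def IsConjugacySeparable : Prop := ∀ g : G, IsClassSeparable C (conjugatesOf g)

variable (G) in
/-- `G` is `C`-cyclic subgroup separable: every cyclic subgroup is `C`-separable. -/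
def IsCyclicSubgroupSeparable : Prop :=
  ∀ g : G, IsClassSeparable C (Subgroup.zpowers g : Set G)

/-- The `C`-depth `D_{G,C}(X, g)`: the least index of a co-`C` subgroup separating `g` from `X`. -/
noncomputable def depth (X : Set G) (g : G) : ℕ :=
  sInf {k | ∃ N : Subgroup G, IsCoClass C N ∧ SeparatedBy N X g ∧ N.index = k}

/-- `D_{G,C,inj}(X)`: the least index of a co-`C` subgroup whose projection is injective on `X`. -/
noncomputable def injDepth (X : Set G) : ℕ :=
  sInf {k | ∃ N : Subgroup G, IsCoClass C N ∧
    Set.InjOn (QuotientGroup.mk : G → G ⧸ N) X ∧ N.index = k}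

/-- Word length of `g` with respect to `S`: the least length of a word in `S ∪ S⁻¹` with value `g`
(used only for `S` generating `G`). -/
noncomputable def wordLength (S : Finset G) (g : G) : ℕ :=
  sInf {k | ∃ w : List G, (∀ x ∈ w, x ∈ S ∨ x⁻¹ ∈ S) ∧ w.prod = g ∧ w.length = k}

/-- The finite set `S` generates `G`. -/
def Generates (S : Finset G) : Prop := Subgroup.closure (S : Set G) = ⊤

/-- The `C`-residual girth function `RG_{G,C,S}`. -/
noncomputable def residualGirth (S : Finset G) (n : ℕ) : ℕ :=
  injDepth C {g : G | wordLength S g ≤ n}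

/-- The `C`-conjugacy separability function `Conj_{G,S,C}`: the maximum of the depths
`D_{G,C}(g^G, h)`. All depths are at least `1`, so `max 1` only fixes the value at those `n` for
which there is no pair `g, h` to separate: the maximum of the empty set is `1`, the order of the
trivial quotient. -/
noncomputable def conjFun (S : Finset G) (n : ℕ) : ℕ :=
  max 1 (sSup {k | ∃ g h : G, h ∉ conjugatesOf g ∧ wordLength S g ≤ n ∧ wordLength S h ≤ n ∧
    k = depth C (conjugatesOf g) h})

/-- The `C`-cyclic subgroup separability function `Cyclic_{G,S,C}`, with the same convention for
the maximum of the empty set. -/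
noncomputable def cyclicFun (S : Finset G) (n : ℕ) : ℕ :=
  max 1 (sSup {k | ∃ g h : G, h ∉ Subgroup.zpowers g ∧ wordLength S g ≤ n ∧ wordLength S h ≤ n ∧
    k = depth C (Subgroup.zpowers g : Set G) h})

/-- `SC_G(g, h)`: the least length of an `x` with `x⁻¹ g x = h`. -/
noncomputable def shortestConjugator (S : Finset G) (g h : G) : ℕ :=
  sInf {k | ∃ x : G, x⁻¹ * g * x = h ∧ k = wordLength S x}

/-- The shortest conjugator function `Short_{G,S}`. -/
noncomputable def shortFun (S : Finset G) (n : ℕ) : ℕ :=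
  sSup {k | ∃ g h : G, IsConj g h ∧ wordLength S g ≤ n ∧ wordLength S h ≤ n ∧
    k = shortestConjugator S g h}

/-- `Φ(n) = Short_G(n) + n`. -/
noncomputable def phiFun (S : Finset G) (n : ℕ) : ℕ := shortFun S n + n

/-- `Ψ(n) = RG_{G,C}(Φ(n)) · Cyclic_{G,C}(Φ(n)) ^ (Φ(n)²)`. -/
noncomputable def psiFun (S : Finset G) (n : ℕ) : ℕ :=
  residualGirth C S (phiFun S n) * cyclicFun C S (phiFun S n) ^ (phiFun S n ^ 2)

end Separability

/-- Asymptotic domination `f ⪯ g`: there is `K` with `f n ≤ K * g (K * n)` for all `n`. -/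
def AsympLE (f g : ℕ → ℕ) : Prop := ∃ K : ℕ, ∀ n : ℕ, f n ≤ K * g (K * n)

section Wreath

variable (A B : Type u) [Group A] [Group B]

/-- The direct sum of copies of `A` indexed by `B`: finitely supported functions `B → A` under
pointwise multiplication. -/
def wreathBase : Subgroup (B → A) where
  carrier := {f | (Function.mulSupport f).Finite}
  one_mem' := by simp
  mul_mem' {f g} hf hg := (hf.union hg).subset (Function.mulSupport_mul f g)
  inv_mem' {f} hf := by simpa using hf

/-- Left translation of finitely supported functions: `(b • f) x = f (b⁻¹ x)`. -/
def wreathShift (b : B) (f : wreathBase A B) : wreathBase A B :=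
  ⟨fun x => f.1 (b⁻¹ * x), by
    have h : (Function.mulSupport f.1).Finite := f.2
    exact h.preimage (f := fun x => b⁻¹ * x) (mul_right_injective b⁻¹).injOn⟩

/-- The action of `B` on the base by group automorphisms. -/
def wreathAction : B →* MulAut (wreathBase A B) where
  toFun b :=
    { toFun := wreathShift A B b
      invFun := wreathShift A B b⁻¹
      left_inv := fun f => by ext x; simp [wreathShift]
      right_inv := fun f => by ext x; simp [wreathShift]
      map_mul' := fun f g => by ext x; simp [wreathShift] }
  map_one' := by ext f x; simp [wreathShift]
  map_mul' b c := by ext f x; simp [wreathShift, mul_assoc]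

/-- The restricted wreath product `A ≀ B = (⨁_B A) ⋊ B`. -/
abbrev RestrictedWreath : Type u := wreathBase A B ⋊[wreathAction A B] B

end Wreath

/-! Conjugacy in `A ≀ B` is governed by products along the orbits `⟨b⟩r` of left translation by `b`.
For abelian `A`, conjugating `(f, b)` by the base changes `f` by a coboundary `k · (b • k)⁻¹`, and
the coboundaries are exactly the functions whose product over every coset is trivial. So `(f, b)`
and `(g, b)` are conjugate iff some `z` centralizing `b` matches all coset products
(`wreathProd_eq_of_conj`, `isConj_of_wreathProd_eq`). For finite `B` and arbitrary `A`, the left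
coordinate of `x ^ n`, with `n` the order of `b`, plays the role of these products, and its values
count up to conjugacy in `A` (`isConj_pow_left_of_conj`, `isConj_of_isConj_pow_left`).

In both cases non-conjugacy is witnessed by finitely many elements that a quotient only has to keep
apart. For finite `B`, one pair in `A` for each possible `z` suffices (`exists_separating_pairs`).
In the abelian case there may be infinitely many `z`, but a nontrivial product of `f` through `t₁`
must be carried to a coset meeting the support of `g`. Hence, modulo `⟨b⟩`, `z` is one of the
elements `s * t₁⁻¹` with `s` in that support, and this holds in every quotient too. It remains to
keep cosets of `⟨b⟩` distinct, which is cyclic subgroup separability, and to keep noncommuting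
elements noncommuting and nontrivial elements of `A` nontrivial (`exists_separating_data`).

Conversely, if `B` is not in `C`, every `C`-quotient of the wreath product kills some `b ≠ 1`, which
identifies two commuting copies of `A` (`IsConjugacySeparable.comm_of_wreath`). A failure of cyclic
separability of `e` from `⟨g⟩` makes `(1, g)` inseparable from a nonconjugate element built from `e`
(`IsConjugacySeparable.cyclic_of_wreath`).

The bounds come from counting and measuring the witnesses. Quadratically many cyclic separations and
one residual girth quotient give `Ψ` as a bound on the index in `B`
(`exists_quotient_of_isConj_right`); the order of the resulting finite wreath product does the rest.
-/

/-! ### Co-`C` subgroups, depths, and closure of `C` under wreath products. -/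

section Classes

variable {C : GroupClass.{u}} {G H : Type u} [Group G] [Group H]

theorem IsExtensionClosedPseudovariety.of_injective (hC : IsExtensionClosedPseudovariety C)
    (φ : G →* H) (hφ : Function.Injective φ) (hH : C H) : C G :=
  hC.iso _ _ (MonoidHom.ofInjective hφ).symm (hC.subgroup H φ.range hH)

theorem IsCoClass.ker (hC : IsExtensionClosedPseudovariety C) (φ : G →* H) (hH : C H) :
    IsCoClass C φ.ker :=
  ⟨inferInstance, hC.iso _ _ (QuotientGroup.quotientKerEquivRange φ).symm
    (hC.subgroup H φ.range hH)⟩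

theorem IsCoClass.comap (hC : IsExtensionClosedPseudovariety C) (φ : G →* H) {N : Subgroup H}
    (hN : IsCoClass C N) : IsCoClass C (N.comap φ) := by
  obtain ⟨hn, hN⟩ := hN
  have := IsCoClass.ker hC ((QuotientGroup.mk' N).comp φ) hN
  rwa [← MonoidHom.comap_ker, QuotientGroup.ker_mk'] at this

theorem IsCoClass.top (hC : IsExtensionClosedPseudovariety C) :
    IsCoClass C (⊤ : Subgroup G) := by
  have := IsCoClass.ker hC (1 : G →* PUnit.{u + 1}) hC.trivial
  rwa [MonoidHom.ker_one] at this

theorem IsCoClass.inf (hC : IsExtensionClosedPseudovariety C) {N M : Subgroup G}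
    (hN : IsCoClass C N) (hM : IsCoClass C M) : IsCoClass C (N ⊓ M) := by
  obtain ⟨_, hN⟩ := hN
  obtain ⟨_, hM⟩ := hM
  have := IsCoClass.ker hC ((QuotientGroup.mk' N).prod (QuotientGroup.mk' M))
    (hC.prod _ _ hN hM)
  rwa [MonoidHom.ker_prod, QuotientGroup.ker_mk', QuotientGroup.ker_mk'] at this

theorem IsCoClass.index_pos (hC : IsExtensionClosedPseudovariety C) {N : Subgroup G}
    (hN : IsCoClass C N) : 0 < N.index := by
  obtain ⟨_, hN⟩ := hN
  have := hC.finite _ hN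
  exact Nat.card_pos

theorem separatedBy_iff {N : Subgroup G} {X : Set G} {g : G} :
    SeparatedBy N X g ↔ ∀ x ∈ X, x⁻¹ * g ∉ N := by
  simp [SeparatedBy, QuotientGroup.eq]

theorem SeparatedBy.mono {N M : Subgroup G} {X : Set G} {g : G} (h : SeparatedBy N X g)
    (hMN : M ≤ N) : SeparatedBy M X g := by
  rw [separatedBy_iff] at *
  exact fun x hx hm => h x hx (hMN hm)

theorem separatedBy_conj_of_hom {φ : G →* H} {g h : G} (hgh : ¬ IsConj (φ g) (φ h)) :
    SeparatedBy φ.ker (conjugatesOf g) h := by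
  rw [separatedBy_iff]
  intro x hx hk
  apply hgh
  have : φ x = φ h := by
    rw [MonoidHom.mem_ker, map_mul, map_inv, inv_mul_eq_one] at hk
    exact hk
  rw [← this]
  exact φ.map_isConj hx

theorem not_isConj_mk_of_separatedBy {N : Subgroup G} [N.Normal] {g h : G}
    (hs : SeparatedBy N (conjugatesOf g) h) :
    ¬ IsConj (QuotientGroup.mk' N g) (QuotientGroup.mk' N h) := by
  intro hc
  obtain ⟨c, hc⟩ := isConj_iff.1 hc
  obtain ⟨c, rfl⟩ := QuotientGroup.mk'_surjective N c
  apply hs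
  refine ⟨c * g * c⁻¹, isConj_iff.2 ⟨c, rfl⟩, ?_⟩
  simpa using hc

theorem depth_le {X : Set G} {g : G} {N : Subgroup G} (hN : IsCoClass C N)
    (hs : SeparatedBy N X g) : depth C X g ≤ N.index :=
  Nat.sInf_le ⟨N, hN, hs, rfl⟩

theorem exists_index_eq_depth {X : Set G} {g : G} (h : ∃ N, IsCoClass C N ∧ SeparatedBy N X g) :
    ∃ N, IsCoClass C N ∧ SeparatedBy N X g ∧ N.index = depth C X g :=
  Nat.sInf_mem (s := {k | ∃ N : Subgroup G, IsCoClass C N ∧ SeparatedBy N X g ∧ N.index = k})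
    (let ⟨N, h1, h2⟩ := h; ⟨_, N, h1, h2, rfl⟩)

theorem depth_conj_le_of_hom (hC : IsExtensionClosedPseudovariety C) (φ : G →* H) (hH : C H)
    {g h : G} (hgh : ¬ IsConj (φ g) (φ h)) : depth C (conjugatesOf g) h ≤ Nat.card H := by
  have := hC.finite _ hH
  refine (depth_le (IsCoClass.ker hC φ hH) (separatedBy_conj_of_hom hgh)).trans ?_
  rw [Subgroup.index_ker]
  exact Finite.card_subtype_le _

/-- Intersect one subgroup per condition: the conditions pass to smaller subgroups, and the index of
an intersection is at most the product of the indices. -/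
theorem exists_isCoClass_forall (hC : IsExtensionClosedPseudovariety C) {ι : Type*}
    (E : Finset ι) (P : ι → Subgroup G → Prop)
    (hP : ∀ i N M, M ≤ N → P i N → P i M) (k : ℕ)
    (h : ∀ i ∈ E, ∃ N, IsCoClass C N ∧ N.index ≤ k ∧ P i N) :
    ∃ N, IsCoClass C N ∧ N.index ≤ k ^ E.card ∧ ∀ i ∈ E, P i N := by
  classical
  induction E using Finset.induction_on with
  | empty => exact ⟨⊤, IsCoClass.top hC, by simp, by simp⟩
  | insert i E hi ih =>
    obtain ⟨N, hN, hk, hE⟩ := ih fun j hj => h j (Finset.mem_insert_of_mem hj)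
    obtain ⟨M, hM, hk', hE'⟩ := h i (Finset.mem_insert_self _ _)
    refine ⟨N ⊓ M, hN.inf hC hM, ?_, ?_⟩
    · rw [Finset.card_insert_of_notMem hi, pow_succ]
      exact Subgroup.index_inf_le.trans (Nat.mul_le_mul hk hk')
    · intro j hj
      rcases Finset.mem_insert.1 hj with rfl | hj
      · exact hP _ _ _ inf_le_right hE'
      · exact hP _ _ _ inf_le_left (hE j hj)

theorem exists_isCoClass_forall' (hC : IsExtensionClosedPseudovariety C) {ι : Type*}
    (E : Finset ι) (P : ι → Subgroup G → Prop)
    (hP : ∀ i N M, M ≤ N → P i N → P i M)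
    (h : ∀ i ∈ E, ∃ N, IsCoClass C N ∧ P i N) :
    ∃ N, IsCoClass C N ∧ ∀ i ∈ E, P i N := by
  choose! N hN using h
  obtain ⟨M, hM, -, hE⟩ := exists_isCoClass_forall hC E P hP (E.sup fun i => (N i).index)
    fun i hi => ⟨N i, (hN i hi).1, Finset.le_sup (f := fun i => (N i).index) hi, (hN i hi).2⟩
  exact ⟨M, hM, hE⟩

/-- The conjugacy class of `1` is a single point, so conjugacy separability contains residual
`C`-ness. -/
theorem IsConjugacySeparable.exists_notMem (h : IsConjugacySeparable C G) {g : G} (hg : g ≠ 1) :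
    ∃ N, IsCoClass C N ∧ g ∉ N := by
  obtain ⟨N, hN, hs⟩ := h 1 g (by simpa [conjugatesOf] using hg)
  exact ⟨N, hN, by simpa using separatedBy_iff.1 hs 1 (by simp [conjugatesOf])⟩

theorem exists_isCoClass_injOn (hC : IsExtensionClosedPseudovariety C)
    (h : IsConjugacySeparable C G) {X : Set G} (hX : X.Finite) :
    ∃ N, IsCoClass C N ∧ Set.InjOn (QuotientGroup.mk : G → G ⧸ N) X := by
  obtain ⟨N, hN, hE⟩ := exists_isCoClass_forall' hC (hX.toFinset ×ˢ hX.toFinset)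
    (fun p N => p.1 ≠ p.2 → p.1⁻¹ * p.2 ∉ N) (fun i N M hMN hi hne hm => hi hne (hMN hm)) (by
      rintro ⟨x, y⟩ -
      by_cases hxy : x = y
      · exact ⟨⊤, IsCoClass.top hC, fun h => (h hxy).elim⟩
      · obtain ⟨N, hN, hn⟩ := h.exists_notMem (g := x⁻¹ * y) (by simpa [inv_mul_eq_one] using hxy)
        exact ⟨N, hN, fun _ => hn⟩)
  refine ⟨N, hN, fun x hx y hy hxy => ?_⟩
  by_contra hne
  exact hE (x, y) (by simp [hx, hy]) hne (QuotientGroup.eq.1 hxy)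

/-- Some co-`C` projection is injective on the whole finite group. -/
theorem IsConjugacySeparable.of_finite (hC : IsExtensionClosedPseudovariety C)
    (h : IsConjugacySeparable C G) [Finite G] : C G := by
  obtain ⟨N, ⟨_, hN⟩, hi⟩ := exists_isCoClass_injOn hC h (Set.toFinite (Set.univ : Set G))
  exact hC.of_injective (QuotientGroup.mk' N) (fun x y hxy => hi trivial trivial hxy) hN

theorem IsExtensionClosedPseudovariety.pi (hC : IsExtensionClosedPseudovariety C) (hG : C G)
    (ι : Type u) [Finite ι] : C (ι → G) := by
  have key : ∀ n : ℕ, C (ULift.{u} (Fin n) → G) := by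
    intro n
    induction n with
    | zero =>
      exact hC.of_injective (1 : _ →* PUnit.{u + 1})
        (fun x y _ => funext fun i => i.down.elim0) hC.trivial
    | succ n ih =>
      refine hC.of_injective (MonoidHom.prod (Pi.evalMonoidHom _ (ULift.up (0 : Fin (n + 1))))
        (MonoidHom.pi fun i : ULift.{u} (Fin n) => Pi.evalMonoidHom _ (ULift.up i.down.succ)))
        ?_ (hC.prod G _ hG ih)
      intro x y hxy
      funext ⟨i⟩
      have h1 := congrArg Prod.fst hxy
      have h2 := congrArg Prod.snd hxy
      refine Fin.cases h1 (fun j => congrFun h2 (ULift.up j)) i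
  obtain ⟨n, ⟨e⟩⟩ := Finite.exists_equiv_fin ι
  exact hC.of_injective (MonoidHom.pi fun i : ULift.{u} (Fin n) =>
    Pi.evalMonoidHom (fun _ : ι => G) (e.symm i.down))
    (fun x y hxy => funext fun i => by
      simpa [MonoidHom.pi_apply] using congrFun hxy (ULift.up (e i))) (key n)

theorem IsExtensionClosedPseudovariety.restrictedWreath (hC : IsExtensionClosedPseudovariety C)
    (hG : C G) (hH : C H) : C (RestrictedWreath G H) := by
  have := hC.finite _ hH
  have hbase : C (wreathBase G H) := hC.subgroup _ _ (hC.pi hG H)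
  let r : RestrictedWreath G H →* H := SemidirectProduct.rightHom
  have hr : Function.Surjective r := SemidirectProduct.rightHom_surjective
  refine hC.extension _ r.ker ?_ ?_
  · refine hC.iso _ _ (MulEquiv.trans (MonoidHom.ofInjective (f := SemidirectProduct.inl)
      SemidirectProduct.inl_injective) (MulEquiv.subgroupCongr ?_)) hbase
    exact SemidirectProduct.range_inl_eq_ker_rightHom
  · exact hC.iso _ _ (QuotientGroup.quotientKerEquivOfSurjective r hr).symm hH

theorem card_restrictedWreath_le [Finite G] [Finite H] :
    Nat.card (RestrictedWreath G H) ≤ Nat.card G ^ Nat.card H * Nat.card H := by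
  rw [SemidirectProduct.card]
  refine Nat.mul_le_mul_right _ ?_
  rw [← Nat.card_fun]
  exact Finite.card_subtype_le _

end Classes

/-! ### Word length and growth of the separability functions. -/

section WordLength

variable {G : Type u} [Group G]

theorem wordLength_le {S : Finset G} {w : List G} (hw : ∀ x ∈ w, x ∈ S ∨ x⁻¹ ∈ S) :
    wordLength S w.prod ≤ w.length :=
  Nat.sInf_le ⟨w, hw, rfl, rfl⟩

theorem Generates.exists_word {S : Finset G} (hS : Generates S) (g : G) :
    ∃ w : List G, (∀ x ∈ w, x ∈ S ∨ x⁻¹ ∈ S) ∧ w.prod = g ∧ w.length = wordLength S g := by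
  refine Nat.sInf_mem (s := {k | ∃ w : List G, (∀ x ∈ w, x ∈ S ∨ x⁻¹ ∈ S) ∧ w.prod = g ∧
    w.length = k}) ?_
  have : g ∈ Subgroup.closure (S : Set G) := by rw [hS]; trivial
  rw [← Subgroup.mem_toSubmonoid, Subgroup.closure_toSubmonoid] at this
  obtain ⟨l, hl, rfl⟩ := Submonoid.exists_list_of_mem_closure this
  exact ⟨_, l, by simpa using hl, rfl, rfl⟩

theorem wordLength_one (S : Finset G) : wordLength S 1 = 0 := by
  have := wordLength_le (S := S) (w := []) (by simp)
  simpa using this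

theorem Generates.wordLength_mul_le {S : Finset G} (hS : Generates S) (g h : G) :
    wordLength S (g * h) ≤ wordLength S g + wordLength S h := by
  obtain ⟨w, hw, rfl, hl⟩ := hS.exists_word g
  obtain ⟨v, hv, rfl, hl'⟩ := hS.exists_word h
  rw [← hl, ← hl', ← List.prod_append, ← List.length_append]
  apply wordLength_le
  intro x hx
  rcases List.mem_append.1 hx with hx | hx
  exacts [hw x hx, hv x hx]

theorem Generates.wordLength_inv_le {S : Finset G} (hS : Generates S) (g : G) :
    wordLength S g⁻¹ ≤ wordLength S g := by
  obtain ⟨w, hw, rfl, hl⟩ := hS.exists_word g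
  rw [← hl, List.prod_inv_reverse]
  refine (wordLength_le ?_).trans (by simp)
  intro x hx
  simp only [List.mem_reverse, List.mem_map] at hx
  obtain ⟨y, hy, rfl⟩ := hx
  simpa using (hw y hy).symm

theorem wordLength_le_one {S : Finset G} {s : G} (hs : s ∈ S) : wordLength S s ≤ 1 := by
  have := wordLength_le (S := S) (w := [s]) (by simp [hs])
  simpa using this

theorem Generates.eq_one_of_wordLength {S : Finset G} (hS : Generates S) {g : G}
    (h : wordLength S g = 0) : g = 1 := by
  obtain ⟨w, hw, rfl, hl⟩ := hS.exists_word g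
  rw [h, List.length_eq_zero_iff] at hl
  simp [hl]

theorem Generates.exists_ne_one [Nontrivial G] {S : Finset G} (hS : Generates S) :
    ∃ s ∈ S, s ≠ 1 := by
  by_contra! h
  have : Subgroup.closure (S : Set G) = ⊥ := by
    rw [Subgroup.closure_eq_bot_iff]
    exact fun s hs => h s hs
  rw [Generates, this] at hS
  exact bot_ne_top hS

/-- An element of length at most `n` is reached from `1` by `n` right multiplications by
generators, their inverses, or `1`. -/
theorem Generates.induction_wordLength {S : Finset G} (hS : Generates S) {p : ℕ → G → Prop}
    (one : p 0 1) (mul : ∀ n g s, (s ∈ S ∨ s⁻¹ ∈ S) → p n g → p (n + 1) (g * s))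
    (g : G) : p (wordLength S g) g := by
  obtain ⟨w, hw, rfl, hl⟩ := hS.exists_word g
  rw [← hl]
  clear hl
  induction w using List.reverseRecOn with
  | nil => simpa using one
  | append_singleton w s ih =>
    rw [List.prod_append, List.prod_singleton, List.length_append, List.length_singleton]
    exact mul _ _ _ (hw s (by simp)) (ih fun x hx => hw x (by simp [hx]))

theorem Generates.finite_ball {S : Finset G} (hS : Generates S) (n : ℕ) :
    {g : G | wordLength S g ≤ n}.Finite := by
  classical
  have key : ∀ n, {g : G | wordLength S g = n}.Finite := by
    intro n
    let T : Set G := {s | s ∈ S ∨ s⁻¹ ∈ S}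
    have hT : T.Finite := by
      refine (S.finite_toSet.union (S.finite_toSet.image fun s => s⁻¹)).subset ?_
      rintro s (hs | hs)
      · exact Or.inl hs
      · exact Or.inr ⟨s⁻¹, hs, inv_inv s⟩
    have : Finite T := hT
    refine ((List.finite_length_eq T n).image fun l => (l.map Subtype.val).prod).subset ?_
    intro g hg
    obtain ⟨w, hw, rfl, hl⟩ := hS.exists_word g
    refine ⟨w.pmap Subtype.mk hw, ?_, ?_⟩
    · simp only [Set.mem_ofPred_eq] at hg ⊢
      simp [hl, hg]
    · simp [List.map_pmap]
  refine ((Set.finite_Iic n).biUnion fun i _ => key i).subset fun g hg => ?_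
  simpa using hg

variable {C : GroupClass.{u}}

/-- The supremum of an unbounded set of naturals is `0`, so finiteness of balls is what makes the
functions dominate their individual terms. Leaving `p` and `v` general serves conjugacy, cyclic and
conjugator functions at once. -/
theorem bddAbove_pairs {S : Finset G} (hS : Generates S) (n : ℕ) (p : G → G → Prop)
    (v : G → G → ℕ) :
    BddAbove {k | ∃ g h : G, p g h ∧ wordLength S g ≤ n ∧ wordLength S h ≤ n ∧ k = v g h} := by
  refine ((((hS.finite_ball n).prod (hS.finite_ball n)).image fun q => v q.1 q.2).subset
    ?_).bddAbove
  rintro k ⟨g, h, -, hg, hh, rfl⟩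
  exact ⟨(g, h), ⟨hg, hh⟩, rfl⟩

theorem sSup_pairs_mono {S : Finset G} (hS : Generates S) {n m : ℕ} (hnm : n ≤ m)
    (p : G → G → Prop) (v : G → G → ℕ) :
    sSup {k | ∃ g h : G, p g h ∧ wordLength S g ≤ n ∧ wordLength S h ≤ n ∧ k = v g h} ≤
    sSup {k | ∃ g h : G, p g h ∧ wordLength S g ≤ m ∧ wordLength S h ≤ m ∧ k = v g h} := by
  refine csSup_le_csSup' (bddAbove_pairs hS m p v) ?_
  rintro k ⟨g, h, hp, hg, hh, rfl⟩
  exact ⟨g, h, hp, hg.trans hnm, hh.trans hnm, rfl⟩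

theorem depth_le_conjFun {S : Finset G} (hS : Generates S) {g h : G} {n : ℕ}
    (hgh : ¬ IsConj g h) (hg : wordLength S g ≤ n) (hh : wordLength S h ≤ n) :
    depth C (conjugatesOf g) h ≤ conjFun C S n :=
  (le_csSup (bddAbove_pairs hS n (fun g h => h ∉ conjugatesOf g)
    fun g h => depth C (conjugatesOf g) h) ⟨g, h, hgh, hg, hh, rfl⟩).trans (le_max_right _ _)

theorem depth_le_cyclicFun {S : Finset G} (hS : Generates S) {g h : G} {n : ℕ}
    (hgh : h ∉ Subgroup.zpowers g) (hg : wordLength S g ≤ n) (hh : wordLength S h ≤ n) :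
    depth C (Subgroup.zpowers g : Set G) h ≤ cyclicFun C S n :=
  (le_csSup (bddAbove_pairs hS n (fun g h => h ∉ Subgroup.zpowers g)
    fun g h => depth C (Subgroup.zpowers g : Set G) h) ⟨g, h, hgh, hg, hh, rfl⟩).trans
    (le_max_right _ _)

theorem one_le_conjFun (S : Finset G) (n : ℕ) : 1 ≤ conjFun C S n := le_max_left _ _

theorem one_le_cyclicFun (S : Finset G) (n : ℕ) : 1 ≤ cyclicFun C S n := le_max_left _ _

theorem conjFun_mono {S : Finset G} (hS : Generates S) : Monotone (conjFun C S) :=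
  fun _ _ hnm => max_le_max le_rfl (sSup_pairs_mono hS hnm (fun g h => h ∉ conjugatesOf g) _)

theorem cyclicFun_mono {S : Finset G} (hS : Generates S) : Monotone (cyclicFun C S) :=
  fun _ _ hnm => max_le_max le_rfl
    (sSup_pairs_mono hS hnm (fun g h => h ∉ Subgroup.zpowers g) _)

theorem conjFun_le {S : Finset G} {n V : ℕ} (hV : 1 ≤ V)
    (h : ∀ g h : G, ¬ IsConj g h → wordLength S g ≤ n → wordLength S h ≤ n →
      depth C (conjugatesOf g) h ≤ V) : conjFun C S n ≤ V := by
  refine max_le hV (csSup_le' ?_)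
  rintro k ⟨g, h', hgh, hg, hh, rfl⟩
  exact h g h' hgh hg hh

theorem shortFun_mono {S : Finset G} (hS : Generates S) : Monotone (shortFun S) :=
  fun _ _ hnm => sSup_pairs_mono hS hnm _ _

theorem exists_conj_wordLength_le {S : Finset G} (hS : Generates S) {g h : G} {n : ℕ}
    (hgh : IsConj g h) (hg : wordLength S g ≤ n) (hh : wordLength S h ≤ n) :
    ∃ x, x⁻¹ * g * x = h ∧ wordLength S x ≤ shortFun S n := by
  have hne : {k | ∃ x : G, x⁻¹ * g * x = h ∧ k = wordLength S x}.Nonempty := by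
    obtain ⟨c, hc⟩ := isConj_iff.1 hgh
    exact ⟨_, c⁻¹, by simpa using hc, rfl⟩
  obtain ⟨x, hx, hk⟩ := Nat.sInf_mem hne
  refine ⟨x, hx, ?_⟩
  rw [← hk]
  exact le_csSup (bddAbove_pairs hS n _ _) ⟨g, h, hgh, hg, hh, rfl⟩

theorem phiFun_mono {S : Finset G} (hS : Generates S) : Monotone (phiFun S) :=
  fun _ _ hnm => Nat.add_le_add (shortFun_mono hS hnm) hnm

theorem exists_index_eq_residualGirth (hC : IsExtensionClosedPseudovariety C) {S : Finset G}
    (hS : Generates S) (hG : IsConjugacySeparable C G) (n : ℕ) :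
    ∃ N, IsCoClass C N ∧ Set.InjOn (QuotientGroup.mk : G → G ⧸ N) {g : G | wordLength S g ≤ n} ∧
      N.index = residualGirth C S n := by
  obtain ⟨N, h1, h2⟩ := exists_isCoClass_injOn hC hG (hS.finite_ball n)
  exact Nat.sInf_mem (s := {k | ∃ N : Subgroup G, IsCoClass C N ∧
    Set.InjOn (QuotientGroup.mk : G → G ⧸ N) {g : G | wordLength S g ≤ n} ∧ N.index = k})
    ⟨_, N, h1, h2, rfl⟩

theorem residualGirth_pos (hC : IsExtensionClosedPseudovariety C) {S : Finset G}
    (hS : Generates S) (hG : IsConjugacySeparable C G) (n : ℕ) : 0 < residualGirth C S n := by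
  obtain ⟨N, h1, -, h3⟩ := exists_index_eq_residualGirth hC hS hG n
  rw [← h3]
  exact h1.index_pos hC

theorem residualGirth_mono (hC : IsExtensionClosedPseudovariety C) {S : Finset G}
    (hS : Generates S) (hG : IsConjugacySeparable C G) : Monotone (residualGirth C S) := by
  intro n m hnm
  obtain ⟨N, h1, h2, h3⟩ := exists_index_eq_residualGirth hC hS hG m
  rw [← h3]
  exact Nat.sInf_le ⟨N, h1, h2.mono fun g hg => le_trans hg hnm, rfl⟩

theorem psiFun_pos (hC : IsExtensionClosedPseudovariety C) {S : Finset G}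
    (hS : Generates S) (hG : IsConjugacySeparable C G) (n : ℕ) : 0 < psiFun C S n :=
  Nat.mul_pos (residualGirth_pos hC hS hG _) (Nat.pow_pos (one_le_cyclicFun _ _))

theorem psiFun_mono (hC : IsExtensionClosedPseudovariety C) {S : Finset G}
    (hS : Generates S) (hG : IsConjugacySeparable C G) : Monotone (psiFun C S) := by
  intro n m hnm
  have h := phiFun_mono hS hnm
  refine Nat.mul_le_mul (residualGirth_mono hC hS hG h) ?_
  exact (Nat.pow_le_pow_left (cyclicFun_mono hS h) _).trans
    (Nat.pow_le_pow_right (one_le_cyclicFun _ _) (Nat.pow_le_pow_left h 2))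

/-- Separating a nontrivial generator from the trivial subgroup needs a proper subgroup. For the
trivial group the function is constantly `1`, which is why trivial `B` is treated apart in the
bounds. -/
theorem two_le_cyclicFun (hC : IsExtensionClosedPseudovariety C) [Nontrivial G] {S : Finset G}
    (hS : Generates S) (hG : IsConjugacySeparable C G) {n : ℕ} (hn : 1 ≤ n) :
    2 ≤ cyclicFun C S n := by
  obtain ⟨s, hs, h1⟩ := hS.exists_ne_one
  have hsep : ∃ N, IsCoClass C N ∧ SeparatedBy N (Subgroup.zpowers (1 : G) : Set G) s := by
    obtain ⟨N, hN, hn⟩ := hG.exists_notMem h1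
    exact ⟨N, hN, separatedBy_iff.2 (by simpa using hn)⟩
  refine le_trans ?_ (depth_le_cyclicFun (C := C) hS (g := 1) (h := s) (by simpa using h1)
    (by simp [wordLength_one]) ((wordLength_le_one hs).trans hn))
  obtain ⟨N, hN, hs, hk⟩ := exists_index_eq_depth hsep
  rw [← hk]
  have h0 := hN.index_pos hC
  have : N.index ≠ 1 := by
    rw [Ne, Subgroup.index_eq_one]
    rintro rfl
    exact separatedBy_iff.1 hs 1 (one_mem _) trivial
  omega

theorem le_psiFun (hC : IsExtensionClosedPseudovariety C) [Nontrivial G] {S : Finset G}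
    (hS : Generates S) (hG : IsConjugacySeparable C G) (n : ℕ) : n ≤ psiFun C S n := by
  rcases Nat.eq_zero_or_pos n with rfl | hn
  · exact Nat.zero_le _
  have hphi : n ≤ phiFun S n := Nat.le_add_left _ _
  calc n ≤ phiFun S n ^ 2 := hphi.trans (Nat.le_self_pow (by norm_num) _)
    _ ≤ 2 ^ (phiFun S n ^ 2) := Nat.lt_two_pow_self.le
    _ ≤ cyclicFun C S (phiFun S n) ^ (phiFun S n ^ 2) :=
        Nat.pow_le_pow_left (two_le_cyclicFun hC hS hG (hn.trans_le hphi)) _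
    _ ≤ psiFun C S n := Nat.le_mul_of_pos_left _ (residualGirth_pos hC hS hG _)

/-- Since `n ≥ 1`, passing to `(a + 1) * n` raises `Φ` by at least `a`, hence the exponent `Φ²` by
at least `a`. With a base of at least `2` this gains a factor `2 ^ a ≥ a`. -/
theorem mul_psiFun_le (hC : IsExtensionClosedPseudovariety C) [Nontrivial G] {S : Finset G}
    (hS : Generates S) (hG : IsConjugacySeparable C G) (a : ℕ) {n : ℕ} (hn : 1 ≤ n) :
    a * psiFun C S n ≤ psiFun C S ((a + 1) * n) := by
  have hle : n ≤ (a + 1) * n := Nat.le_mul_of_pos_left _ (by omega)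
  have hphi : phiFun S n + a ≤ phiFun S ((a + 1) * n) := by
    have := shortFun_mono hS hle
    unfold phiFun
    nlinarith
  have hmono : phiFun S n ≤ phiFun S ((a + 1) * n) := phiFun_mono hS hle
  have h1 : 1 ≤ phiFun S ((a + 1) * n) :=
    hn.trans (hle.trans (Nat.le_add_left _ _))
  have h2 := two_le_cyclicFun hC hS hG h1
  have hsq : phiFun S n ^ 2 + a ≤ phiFun S ((a + 1) * n) ^ 2 := by nlinarith
  calc a * psiFun C S n
      = residualGirth C S (phiFun S n) *
        (cyclicFun C S (phiFun S n) ^ (phiFun S n ^ 2) * a) := by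
        unfold psiFun; ring
    _ ≤ residualGirth C S (phiFun S ((a + 1) * n)) *
        (cyclicFun C S (phiFun S ((a + 1) * n)) ^ (phiFun S n ^ 2) *
          cyclicFun C S (phiFun S ((a + 1) * n)) ^ a) := by
        refine Nat.mul_le_mul (residualGirth_mono hC hS hG hmono) (Nat.mul_le_mul
          (Nat.pow_le_pow_left (cyclicFun_mono hS hmono) _) ?_)
        exact Nat.lt_two_pow_self.le.trans (Nat.pow_le_pow_left h2 a)
    _ ≤ psiFun C S ((a + 1) * n) := by
        unfold psiFun
        rw [← pow_add]
        exact Nat.mul_le_mul_left _ (Nat.pow_le_pow_right (by omega) hsq)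

end WordLength

/-! ### One-point functions in the base, and cosets of a cyclic subgroup. -/

section WreathBase

variable {A B : Type u} [Group A]

theorem wreathBase_ext {f g : wreathBase A B} (h : ∀ t, f.1 t = g.1 t) : f = g :=
  Subtype.ext (funext h)

open Classical in
/-- The homomorphism embedding `A` as the `t`-th summand of the base. -/
noncomputable def wreathSingle (t : B) : A →* wreathBase A B :=
  (MonoidHom.mulSingle (fun _ : B => A) t).codRestrict (wreathBase A B) fun _ =>
    (Set.finite_singleton t).subset Pi.mulSupport_mulSingle_subset

open Classical in
theorem wreathSingle_apply (t : B) (a : A) (x : B) :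
    (wreathSingle t a).1 x = if x = t then a else 1 :=
  Pi.mulSingle_apply t a x

theorem wreathBase_induction {p : wreathBase A B → Prop} (one : p 1)
    (single_mul : ∀ t a f, p f → p (wreathSingle t a * f)) (f : wreathBase A B) : p f := by
  classical
  have key : ∀ (s : Finset B) (f : wreathBase A B), (∀ t, f.1 t ≠ 1 → t ∈ s) → p f := by
    intro s
    induction s using Finset.induction_on with
    | empty =>
      intro f hf
      have : f = 1 := wreathBase_ext fun t => by simpa using hf t
      exact this ▸ one
    | insert t s _ ih =>
      intro f hf
      have := single_mul t (f.1 t) (wreathSingle t (f.1 t)⁻¹ * f) (ih _ fun x hx => ?_)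
      · rwa [← mul_assoc, ← map_mul, mul_inv_cancel, map_one, one_mul] at this
      · have hx' : (wreathSingle t (f.1 t)⁻¹).1 x * f.1 x ≠ 1 := hx
        rw [wreathSingle_apply] at hx'
        by_cases hxt : x = t
        · simp [hxt] at hx'
        · simp only [hxt, if_false, one_mul] at hx'
          exact Finset.mem_of_mem_insert_of_ne (hf x hx') hxt
  have hf : (Function.mulSupport f.1).Finite := f.2
  exact key hf.toFinset f fun t ht => hf.mem_toFinset.2 ht

/-- One-point functions generate the base; most identities about the base below are checked on them
through this lemma. -/
theorem wreathBase_hom_ext {M : Type*} [MulOneClass M] {φ ψ : wreathBase A B →* M}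
    (h : ∀ t a, φ (wreathSingle t a) = ψ (wreathSingle t a)) : φ = ψ := by
  ext f
  induction f using wreathBase_induction with
  | one => simp
  | single_mul t a f ih => rw [map_mul, map_mul, h, ih]

variable [Group B]

theorem wreathAction_apply (b : B) (f : wreathBase A B) (t : B) :
    (wreathAction A B b f).1 t = f.1 (b⁻¹ * t) := rfl

theorem wreathAction_single (b t : B) (a : A) :
    wreathAction A B b (wreathSingle t a) = wreathSingle (b * t) a := by
  refine wreathBase_ext fun x => ?_
  rw [wreathAction_apply, wreathSingle_apply, wreathSingle_apply]
  have h : b⁻¹ * x = t ↔ x = b * t := inv_mul_eq_iff_eq_mul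
  by_cases hx : x = b * t
  · rw [if_pos hx, if_pos (h.2 hx)]
  · rw [if_neg hx, if_neg (mt h.1 hx)]

/-- Right cosets of the cyclic group generated by `b`. -/
def cyclicCoset (b r : B) : Set B := {t | t * r⁻¹ ∈ Subgroup.zpowers b}

theorem mem_cyclicCoset {b r t : B} : t ∈ cyclicCoset b r ↔ t * r⁻¹ ∈ Subgroup.zpowers b :=
  Iff.rfl

theorem cyclicCoset_eq {b r s : B} (h : s ∈ cyclicCoset b r) :
    cyclicCoset b s = cyclicCoset b r := by
  ext t
  rw [mem_cyclicCoset, mem_cyclicCoset]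
  have : t * r⁻¹ = (t * s⁻¹) * (s * r⁻¹) := by group
  rw [this, Subgroup.mul_mem_cancel_right _ (mem_cyclicCoset.1 h)]

theorem conj_mem_zpowers {b z e : B} (h : z * b = b * z) :
    z * e * z⁻¹ ∈ Subgroup.zpowers b ↔ e ∈ Subgroup.zpowers b := by
  have key : ∀ z e : B, Commute z b → e ∈ Subgroup.zpowers b →
      z * e * z⁻¹ ∈ Subgroup.zpowers b := by
    rintro z _ h ⟨i, rfl⟩
    refine ⟨i, ?_⟩
    simp only [(h.zpow_right i).eq, mul_inv_cancel_right]
  refine ⟨fun he => ?_, key z e h⟩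
  have := key z⁻¹ _ (Commute.inv_left h) he
  simpa [mul_assoc] using this

end WreathBase

/-! ### Abelian `A`: coset products decide conjugacy. -/

section Commutative

variable {A B A' B' : Type u} [CommGroup A] [CommGroup A']

/-- The product of the values of `f` over a set `P`. -/
noncomputable def wreathProd (P : Set B) : wreathBase A B →* A where
  toFun f := ∏ᶠ t ∈ P, f.1 t
  map_one' := finprod_mem_one P
  map_mul' f g := finprod_mem_mul_distrib'
    (Set.Finite.subset f.2 Set.inter_subset_right) (Set.Finite.subset g.2 Set.inter_subset_right)

/-- Only the trace of the set on the support matters. This is what lets a coset taken in a quotient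
of `B` be replaced by a coset in `B`. -/
theorem wreathProd_congr {P Q : Set B} {f : wreathBase A B}
    (h : ∀ t, f.1 t ≠ 1 → (t ∈ P ↔ t ∈ Q)) : wreathProd P f = wreathProd Q f :=
  finprod_mem_inter_mulSupport_eq' _ _ _ h

theorem exists_of_wreathProd_ne_one {P : Set B} {f : wreathBase A B}
    (h : wreathProd P f ≠ 1) : ∃ t ∈ P, f.1 t ≠ 1 :=
  exists_ne_one_of_finprod_mem_ne_one h

open Classical in
theorem wreathProd_single (P : Set B) (t : B) (a : A) :
    wreathProd P (wreathSingle t a) = if t ∈ P then a else 1 := by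
  change ∏ᶠ x ∈ P, (wreathSingle t a).1 x = _
  rw [finprod_mem_def, finprod_eq_single _ t]
  · simp [Set.mulIndicator_apply, wreathSingle_apply]
  · intro x hx
    simp [Set.mulIndicator_apply, wreathSingle_apply, hx]

/-- Push a finitely supported function forward along `ρ`, applying `α` to the values. -/
noncomputable def wreathMapBase (α : A →* A') (ρ : B → B') :
    wreathBase A B →* wreathBase A' B' where
  toFun f := ⟨fun q => α (wreathProd (ρ ⁻¹' {q}) f), by
    refine (Set.Finite.image ρ f.2).subset fun q hq => ?_
    obtain ⟨t, ht, h1⟩ := exists_of_wreathProd_ne_one (P := ρ ⁻¹' {q}) (f := f)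
      (fun h => hq (by simp only [h, map_one]))
    exact ⟨t, h1, ht⟩⟩
  map_one' := wreathBase_ext fun q => by
    change α _ = 1
    simp
  map_mul' f g := wreathBase_ext fun q => by
    change α _ = α _ * α _
    simp

theorem wreathMapBase_single (α : A →* A') (ρ : B → B') (t : B) (a : A) :
    wreathMapBase α ρ (wreathSingle t a) = wreathSingle (ρ t) (α a) := by
  classical
  refine wreathBase_ext fun q => ?_
  change α _ = _
  rw [wreathProd_single, wreathSingle_apply]
  simp only [Set.mem_preimage, Set.mem_singleton_iff, apply_ite α, map_one, eq_comm]

theorem wreathProd_mapBase (α : A →* A') (ρ : B → B') (P : Set B') (f : wreathBase A B) :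
    wreathProd P (wreathMapBase α ρ f) = α (wreathProd (ρ ⁻¹' P) f) := by
  classical
  have : (wreathProd P).comp (wreathMapBase α ρ) = α.comp (wreathProd (ρ ⁻¹' P)) := by
    refine wreathBase_hom_ext fun t a => ?_
    rw [MonoidHom.comp_apply, MonoidHom.comp_apply, wreathMapBase_single, wreathProd_single,
      wreathProd_single, apply_ite α, map_one]
    rfl
  exact DFunLike.congr_fun this f

variable [Group B] [Group B']

theorem wreathProd_action (P : Set B) (b : B) (f : wreathBase A B) :
    wreathProd P (wreathAction A B b f) = wreathProd {t | b * t ∈ P} f := by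
  have : (wreathProd P).comp (wreathAction A B b).toMonoidHom =
      wreathProd (A := A) {t | b * t ∈ P} := by
    refine wreathBase_hom_ext fun t a => ?_
    rw [MonoidHom.comp_apply, MulEquiv.coe_toMonoidHom, wreathAction_single, wreathProd_single,
      wreathProd_single]
    rfl
  exact DFunLike.congr_fun this f

/-- The homomorphism of wreath products induced by homomorphisms of abelian groups `A → A'` and of
groups `B → B'`. -/
noncomputable def wreathMap (α : A →* A') (β : B →* B') :
    RestrictedWreath A B →* RestrictedWreath A' B' :=
  SemidirectProduct.map (wreathMapBase α β) β fun b => by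
    refine wreathBase_hom_ext fun t a => ?_
    simp [wreathAction_single, wreathMapBase_single]

/-- In `k · (z • f) = g · (c • k)` the products of `k` and of `c • k` over a `⟨c⟩`-coset agree, as
the coset is stable under `c`, and they cancel in the abelian group. -/
theorem wreathProd_eq_of_conj {f g k : wreathBase A B} {b c z : B}
    (h : (⟨k, z⟩ : RestrictedWreath A B) * ⟨f, b⟩ = ⟨g, c⟩ * ⟨k, z⟩) (r : B) :
    wreathProd {t | z * t ∈ cyclicCoset c r} f = wreathProd (cyclicCoset c r) g := by
  have h1 : k * wreathAction A B z f = g * wreathAction A B c k :=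
    congrArg SemidirectProduct.left h
  have h2 := congrArg (wreathProd (cyclicCoset c r)) h1
  rw [map_mul, map_mul, wreathProd_action, wreathProd_action] at h2
  have h3 : {t | c * t ∈ cyclicCoset c r} = cyclicCoset c r := by
    ext t
    rw [Set.mem_ofPred_eq, mem_cyclicCoset, mem_cyclicCoset, mul_assoc,
      Subgroup.mul_mem_cancel_left _ (Subgroup.mem_zpowers c)]
  rw [h3, mul_comm] at h2
  exact mul_right_cancel h2

/-- Modulo coboundaries `⟨b⟩` acts trivially, so all values of `f` can be gathered at one
representative of each coset without changing its class. The gathered function has the coset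
products as its values, hence is trivial. -/
theorem exists_eq_mul_action_inv {b : B} {f : wreathBase A B}
    (h : ∀ r, wreathProd (cyclicCoset b r) f = 1) :
    ∃ k, f = k * (wreathAction A B b k)⁻¹ := by
  let δ : wreathBase A B →* wreathBase A B :=
    { toFun := fun k => k * (wreathAction A B b k)⁻¹
      map_one' := by simp
      map_mul' := fun k l => by rw [map_mul, mul_inv, mul_mul_mul_comm] }
  let π := QuotientGroup.mk' δ.range
  have hπ : ∀ c ∈ Subgroup.zpowers b, ∀ k, π (wreathAction A B c k) = π k := by
    let T : Subgroup B :=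
      { carrier := {c | ∀ k, π (wreathAction A B c k) = π k}
        one_mem' := fun k => by simp
        mul_mem' := fun {c d} hc hd k => by rw [map_mul, MulAut.mul_apply, hc, hd]
        inv_mem' := fun {c} hc k => by
          rw [← hc, ← MulAut.mul_apply, ← map_mul, mul_inv_cancel, map_one, MulAut.one_apply] }
    have : Subgroup.zpowers b ≤ T := by
      rw [Subgroup.zpowers_le]
      intro k
      exact QuotientGroup.eq.2 ⟨k, by simp [δ, mul_comm]⟩
    exact fun c hc => this hc
  let s := QuotientGroup.rightRel (Subgroup.zpowers b)
  -- The map to coset representatives is not a homomorphism; `wreathMapBase` accepts any map of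
  -- index sets.
  let ρ : B → B := fun t => (Quotient.mk s t).out
  have hρ : ∀ t, t ∈ cyclicCoset b (ρ t) := fun t =>
    QuotientGroup.rightRel_apply.1 (Quotient.mk_out (s := s) t)
  have hπρ : π = π.comp (wreathMapBase (MonoidHom.id A) ρ) := by
    refine wreathBase_hom_ext fun t a => ?_
    have := hπ _ (hρ t) (wreathSingle (ρ t) a)
    rw [wreathAction_single, inv_mul_cancel_right] at this
    rw [MonoidHom.comp_apply, wreathMapBase_single, MonoidHom.id_apply, this]
  have h1 : wreathMapBase (MonoidHom.id A) ρ f = 1 := by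
    refine wreathBase_ext fun q => ?_
    change wreathProd (ρ ⁻¹' {q}) f = 1
    by_contra hne
    obtain ⟨t, rfl, -⟩ := exists_of_wreathProd_ne_one hne
    apply hne
    rw [← h (ρ t)]
    refine wreathProd_congr fun x _ => ?_
    refine ⟨fun hx => ?_, fun hx => ?_⟩
    · have hx : ρ x = ρ t := hx
      rw [← hx]
      exact hρ x
    · have h2 : x ∈ cyclicCoset b t := by rwa [cyclicCoset_eq (hρ t)]
      exact congrArg Quotient.out (Quotient.sound (s := s)
        (Setoid.symm' _ (QuotientGroup.rightRel_apply.2 h2)))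
  have h2 : π f = 1 := by rw [hπρ, MonoidHom.comp_apply, h1, map_one]
  obtain ⟨k, hk⟩ := (QuotientGroup.eq_one_iff f).1 h2
  exact ⟨k, hk.symm⟩

theorem isConj_of_wreathProd_eq {f g : wreathBase A B} {b z : B} (hz : z * b = b * z)
    (h : ∀ r, wreathProd {t | z * t ∈ cyclicCoset b r} f = wreathProd (cyclicCoset b r) g) :
    IsConj (⟨f, b⟩ : RestrictedWreath A B) ⟨g, b⟩ := by
  obtain ⟨k, hk⟩ := exists_eq_mul_action_inv (b := b) (f := g * (wreathAction A B z f)⁻¹) (by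
    intro r
    rw [map_mul, map_inv, wreathProd_action, h, mul_inv_cancel])
  rw [isConj_iff]
  refine ⟨⟨k, z⟩, ?_⟩
  rw [mul_inv_eq_iff_eq_mul]
  refine SemidirectProduct.ext ?_ hz
  change k * wreathAction A B z f = g * wreathAction A B b k
  rw [mul_inv_eq_iff_eq_mul, mul_right_comm, eq_mul_inv_iff_mul_eq] at hk
  exact hk.symm

end Commutative

/-! ### Length functions and the length of a coset product. -/

section Length

variable {G : Type u}

/-- Subadditive, symmetric length functions on a group. -/
structure IsLength [Group G] (l : G → ℕ) : Prop where
  one : l 1 = 0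
  mul_le : ∀ x y, l (x * y) ≤ l x + l y
  inv_le : ∀ x, l x⁻¹ ≤ l x

theorem Generates.isLength [Group G] {S : Finset G} (hS : Generates S) : IsLength (wordLength S) :=
  ⟨wordLength_one S, hS.wordLength_mul_le, hS.wordLength_inv_le⟩

/-- The zero length turns the quantitative lemmas into qualitative ones, and stands in for a group
without a chosen generating set. -/
theorem isLength_zero [Group G] : IsLength (fun _ : G => 0) := ⟨rfl, by simp, by simp⟩

theorem IsLength.div_le [Group G] {l : G → ℕ} (hl : IsLength l) (x y : G) :
    l (x * y⁻¹) ≤ l x + l y :=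
  (hl.mul_le _ _).trans (Nat.add_le_add_left (hl.inv_le _) _)

theorem IsLength.prod_le [CommGroup G] {l : G → ℕ} (hl : IsLength l) {ι : Type*} (s : Finset ι)
    (f : ι → G) {k : ℕ} (h : ∀ i ∈ s, l (f i) ≤ k) : l (∏ i ∈ s, f i) ≤ s.card * k := by
  classical
  induction s using Finset.induction_on with
  | empty => simp [hl.one]
  | insert i s hi ih =>
    rw [Finset.prod_insert hi, Finset.card_insert_of_notMem hi, add_mul, one_mul, add_comm]
    exact (hl.mul_le _ _).trans (Nat.add_le_add (h i (Finset.mem_insert_self _ _))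
      (ih fun j hj => h j (Finset.mem_insert_of_mem hj)))

theorem IsLength.wreathProd_le [CommGroup G] {B : Type u} {l : G → ℕ} (hl : IsLength l)
    (f : wreathBase G B) {m k : ℕ} (hm : (Function.mulSupport f.1).ncard ≤ m)
    (h : ∀ t, l (f.1 t) ≤ k) (P : Set B) : l (wreathProd P f) ≤ m * k := by
  classical
  have hf : (Function.mulSupport f.1).Finite := f.2
  have : wreathProd P f = ∏ t ∈ hf.toFinset.filter (· ∈ P), f.1 t := by
    change ∏ᶠ t ∈ P, f.1 t = _
    rw [finprod_mem_eq_prod_filter _ P hf]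
  rw [this]
  refine (hl.prod_le _ _ fun t _ => h t).trans (Nat.mul_le_mul_right _ ?_)
  refine (Finset.card_filter_le _ _).trans ?_
  rwa [← Set.ncard_eq_toFinset_card _ hf]

end Length

/-! ### Abelian `A`: finitely many witnesses of non-conjugacy, with their lengths. -/

section SeparatingData

variable {A B : Type u} [CommGroup A] [Group B]

/-- Finitely many elements of `B` and `A` whose separation in quotients keeps `(f, b)` and `(g, b)`
non-conjugate in the quotient wreath product. -/
theorem exists_separating_data_of_ne_one {lA : A → ℕ} {lB : B → ℕ} (hlA : IsLength lA)
    (hlB : IsLength lB) {f g : wreathBase A B} {b y w : B} {m k σ : ℕ}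
    (hfm : (Function.mulSupport f.1).ncard ≤ m) (hgm : (Function.mulSupport g.1).ncard ≤ m)
    (hfB : ∀ t, f.1 t ≠ 1 → lB (y⁻¹ * t) ≤ k) (hgB : ∀ t, g.1 t ≠ 1 → lB (w⁻¹ * t) ≤ k)
    (hfA : ∀ t, lA (f.1 t) ≤ k) (hgA : ∀ t, lA (g.1 t) ≤ k)
    (hy : lB (y⁻¹ * b * y) ≤ k) (hw : lB (w⁻¹ * b * w) ≤ k) (hσ : lB y + lB w ≤ σ)
    (hfg : ¬ IsConj (⟨f, b⟩ : RestrictedWreath A B) ⟨g, b⟩) {t₀ : B}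
    (ht₀ : wreathProd (cyclicCoset b t₀) f ≠ 1) :
    ∃ (E : Finset B) (L : Finset (B × B)) (D : Finset A),
      E.card ≤ m + 2 * m ^ 2 ∧ D.card ≤ m + 1 ∧
      (∀ e ∈ E, e ∉ Subgroup.zpowers b ∧
        ∃ p, lB (p⁻¹ * e * p) ≤ 4 * k ∧ lB (p⁻¹ * b * p) ≤ k) ∧
      (∀ q ∈ L, q.1 ≠ q.2 ∧ lB q.1 ≤ σ + 3 * k ∧ lB q.2 ≤ σ + 3 * k) ∧
      (∀ d ∈ D, d ≠ 1 ∧ lA d ≤ 2 * (m * k)) ∧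
      ∀ (A' B' : Type u) [CommGroup A'] [Group B'] (α : A →* A') (β : B →* B'),
        (∀ e ∈ E, β e ∉ Subgroup.zpowers (β b)) → (∀ q ∈ L, β q.1 ≠ β q.2) →
        (∀ d ∈ D, α d ≠ 1) → ¬ IsConj (wreathMap α β ⟨f, b⟩) (wreathMap α β ⟨g, b⟩) := by
  classical
  obtain ⟨t₁, ht₁, hft₁⟩ := exists_of_wreathProd_ne_one ht₀
  rw [← cyclicCoset_eq ht₁] at ht₀
  clear ht₁ t₀
  have hf : (Function.mulSupport f.1).Finite := f.2
  have hg : (Function.mulSupport g.1).Finite := g.2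
  set F := hf.toFinset with hF
  set Γ := hg.toFinset with hΓ
  have memF : ∀ {t}, t ∈ F ↔ f.1 t ≠ 1 := fun {t} => hf.mem_toFinset
  have memΓ : ∀ {t}, t ∈ Γ ↔ g.1 t ≠ 1 := fun {t} => hg.mem_toFinset
  have hFm : F.card ≤ m := by rwa [hF, ← Set.ncard_eq_toFinset_card _ hf]
  have hΓm : Γ.card ≤ m := by rwa [hΓ, ← Set.ncard_eq_toFinset_card _ hg]
  -- These are the only candidates for a conjugating element modulo `⟨b⟩`: it must send the coset of
  -- `t₁` to the coset of some `s` in the support of `g`.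
  let z : B → B := fun s => s * t₁⁻¹
  -- A coset on which the products differ meets the support of `g` or of the translate of `f`, so
  -- its representative can be taken there. This is what bounds the lengths below.
  have hr : ∀ s, z s * b = b * z s → ∃ r, (g.1 r ≠ 1 ∨ ∃ t, f.1 t ≠ 1 ∧ r = z s * t) ∧
      wreathProd {t | z s * t ∈ cyclicCoset b r} f ≠ wreathProd (cyclicCoset b r) g := by
    intro s hs
    by_contra! hcon
    refine hfg (isConj_of_wreathProd_eq hs fun r => ?_)
    by_contra hne
    by_cases h1 : wreathProd (cyclicCoset b r) g = 1
    · rw [h1] at hne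
      obtain ⟨t, ht, hft⟩ := exists_of_wreathProd_ne_one hne
      have := hcon (z s * t) (Or.inr ⟨t, hft, rfl⟩)
      rw [cyclicCoset_eq ht, h1] at this
      exact hne this
    · obtain ⟨t, ht, hgt⟩ := exists_of_wreathProd_ne_one h1
      have := hcon t (Or.inl hgt)
      rw [cyclicCoset_eq ht] at this
      exact hne this
  choose! r hrmem hrne using hr
  let Γc := Γ.filter fun s => z s * b = b * z s
  have memΓc : ∀ {s}, s ∈ Γc ↔ g.1 s ≠ 1 ∧ z s * b = b * z s := fun {s} => by
    rw [Finset.mem_filter, memΓ]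
  have hΓcm : Γc.card ≤ m := (Finset.card_filter_le _ _).trans hΓm
  -- The first family keeps the coset of `t₁` apart from the others met by `f`; the other two keep
  -- the coset of `r s` apart from those met by the translate of `f` and by `g`.
  let E : Finset B := (F.image (fun t => t * t₁⁻¹) ∪
    ((Γc ×ˢ F).image (fun p => z p.1 * p.2 * (r p.1)⁻¹) ∪
      (Γc ×ˢ Γ).image (fun p => p.2 * (r p.1)⁻¹))).filter (· ∉ Subgroup.zpowers b)
  -- Candidates that do not commute with `b` are excluded by keeping this failure visible in the
  -- quotient.
  let L : Finset (B × B) := (Γ.filter fun s => ¬ z s * b = b * z s).image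
    fun s => (z s * b, b * z s)
  let D : Finset A := insert (wreathProd (cyclicCoset b t₁) f) (Γc.image fun s =>
    wreathProd {t | z s * t ∈ cyclicCoset b (r s)} f * (wreathProd (cyclicCoset b (r s)) g)⁻¹)
  have l2 : ∀ {x₁ x₂ : B}, lB x₁ ≤ k → lB x₂ ≤ k → lB (x₁ * x₂⁻¹) ≤ 2 * k := by
    intro x₁ x₂ h1 h2
    have := hlB.div_le x₁ x₂
    omega
  have l4 : ∀ {x₁ x₂ x₃ x₄ : B}, lB x₁ ≤ k → lB x₂ ≤ k → lB x₃ ≤ k → lB x₄ ≤ k →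
      lB (x₁ * x₂⁻¹ * x₃ * x₄⁻¹) ≤ 4 * k := by
    intro x₁ x₂ x₃ x₄ h1 h2 h3 h4
    have := l2 h1 h2
    have := hlB.mul_le (x₁ * x₂⁻¹) x₃
    have := hlB.div_le (x₁ * x₂⁻¹ * x₃) x₄
    omega
  refine ⟨E, L, D, ?_, ?_, ?_, ?_, ?_, ?_⟩
  · refine (Finset.card_filter_le _ _).trans ((Finset.card_union_le _ _).trans
      (Nat.add_le_add (Finset.card_image_le.trans hFm)
        ((Finset.card_union_le _ _).trans ?_)))
    have h1 := (Finset.card_image_le (s := Γc ×ˢ F) (f := fun p => z p.1 * p.2 * (r p.1)⁻¹))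
    have h2 := (Finset.card_image_le (s := Γc ×ˢ Γ) (f := fun p => p.2 * (r p.1)⁻¹))
    rw [Finset.card_product] at h1 h2
    have h3 := Nat.mul_le_mul hΓcm hFm
    have h4 := Nat.mul_le_mul hΓcm hΓm
    rw [pow_two]
    omega
  · exact (Finset.card_insert_le _ _).trans
      (Nat.add_le_add_right (Finset.card_image_le.trans hΓcm) 1)
  · intro e he
    rw [Finset.mem_filter] at he
    refine ⟨he.2, ?_⟩
    have he := he.1
    simp only [Finset.mem_union, Finset.mem_image, Finset.mem_product, memF, memΓ, memΓc,
      Prod.exists] at he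
    rcases he with ⟨t, ht, rfl⟩ | ⟨s, t, ⟨⟨hs, hc⟩, ht⟩, rfl⟩ | ⟨s, t, ⟨⟨hs, hc⟩, ht⟩, rfl⟩
    · refine ⟨y, ?_, hy⟩
      have := l2 (hfB t ht) (hfB t₁ hft₁)
      have h2 : y⁻¹ * (t * t₁⁻¹) * y = y⁻¹ * t * (y⁻¹ * t₁)⁻¹ := by group
      rw [h2]
      omega
    · rcases hrmem s hc with h1 | ⟨t', ht', h1⟩
      · refine ⟨w, ?_, hw⟩
        have := l4 (hgB s hs) (hfB t₁ hft₁) (hfB t ht) (hgB _ h1)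
        have h2 : w⁻¹ * (z s * t * (r s)⁻¹) * w =
          w⁻¹ * s * (y⁻¹ * t₁)⁻¹ * (y⁻¹ * t) * (w⁻¹ * r s)⁻¹ := by simp only [z]; group
        rwa [h2]
      -- As `z s` commutes with `b`, including it in `p` leaves the conjugate of `b` unchanged, and
      -- it cancels the long factor `z s` in `e`.
      · refine ⟨z s * y, ?_, ?_⟩
        · have := l2 (hfB t ht) (hfB t' ht')
          have h2 : (z s * y)⁻¹ * (z s * t * (r s)⁻¹) * (z s * y) =
            y⁻¹ * t * (y⁻¹ * t')⁻¹ := by rw [h1]; group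
          rw [h2]
          omega
        · have h2 : (z s * y)⁻¹ * b * (z s * y) = y⁻¹ * b * y := by
            rw [mul_assoc, ← mul_assoc b, ← hc]; group
          rwa [h2]
    · refine ⟨w, ?_, hw⟩
      rcases hrmem s hc with h1 | ⟨t', ht', h1⟩
      · have := l2 (hgB t ht) (hgB _ h1)
        have h2 : w⁻¹ * (t * (r s)⁻¹) * w = w⁻¹ * t * (w⁻¹ * r s)⁻¹ := by group
        rw [h2]
        omega
      · have := l4 (hgB t ht) (hfB t' ht') (hfB t₁ hft₁) (hgB s hs)
        have h2 : w⁻¹ * (t * (r s)⁻¹) * w =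
          w⁻¹ * t * (y⁻¹ * t')⁻¹ * (y⁻¹ * t₁) * (w⁻¹ * s)⁻¹ := by rw [h1]; simp only [z]; group
        rwa [h2]
  · intro q hq
    simp only [L, Finset.mem_image, Finset.mem_filter, memΓ] at hq
    obtain ⟨s, ⟨hs, hc⟩, rfl⟩ := hq
    have hs' := hgB s hs
    have ht' := hfB t₁ hft₁
    refine ⟨hc, ?_, ?_⟩
    · have h2 : z s * b = w * (w⁻¹ * s * (y⁻¹ * t₁)⁻¹ * (y⁻¹ * b * y)) * y⁻¹ := by
        simp only [z]; group
      have h3 := l2 hs' ht'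
      have h4 := hlB.mul_le (w⁻¹ * s * (y⁻¹ * t₁)⁻¹) (y⁻¹ * b * y)
      have h5 := hlB.mul_le w (w⁻¹ * s * (y⁻¹ * t₁)⁻¹ * (y⁻¹ * b * y))
      have h6 := hlB.div_le (w * (w⁻¹ * s * (y⁻¹ * t₁)⁻¹ * (y⁻¹ * b * y))) y
      change lB (z s * b) ≤ _
      rw [h2]
      omega
    · have h2 : b * z s = w * ((w⁻¹ * b * w) * (w⁻¹ * s * (y⁻¹ * t₁)⁻¹)) * y⁻¹ := by
        simp only [z]; group
      have h3 := l2 hs' ht'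
      have h4 := hlB.mul_le (w⁻¹ * b * w) (w⁻¹ * s * (y⁻¹ * t₁)⁻¹)
      have h5 := hlB.mul_le w ((w⁻¹ * b * w) * (w⁻¹ * s * (y⁻¹ * t₁)⁻¹))
      have h6 := hlB.div_le (w * ((w⁻¹ * b * w) * (w⁻¹ * s * (y⁻¹ * t₁)⁻¹))) y
      change lB (b * z s) ≤ _
      rw [h2]
      omega
  · intro d hd
    rcases Finset.mem_insert.1 hd with rfl | hd
    · have := hlA.wreathProd_le f hfm hfA (cyclicCoset b t₁)
      exact ⟨ht₀, by omega⟩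
    · obtain ⟨s, hs, rfl⟩ := Finset.mem_image.1 hd
      have h1 := hlA.wreathProd_le f hfm hfA {t | z s * t ∈ cyclicCoset b (r s)}
      have h2 := hlA.wreathProd_le g hgm hgA (cyclicCoset b (r s))
      refine ⟨?_, (hlA.div_le _ _).trans (by omega)⟩
      rw [Ne, mul_inv_eq_one]
      exact hrne s (memΓc.1 hs).2
  · intro A' B' _ _ α β hE hL hD hconj
    have hE' : ∀ e, e ∈ F.image (fun t => t * t₁⁻¹) ∪
        ((Γc ×ˢ F).image (fun p => z p.1 * p.2 * (r p.1)⁻¹) ∪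
        (Γc ×ˢ Γ).image (fun p => p.2 * (r p.1)⁻¹)) →
        (β e ∈ Subgroup.zpowers (β b) ↔ e ∈ Subgroup.zpowers b) := by
      intro e he
      constructor
      · intro h1
        by_contra h2
        exact hE e (Finset.mem_filter.2 ⟨he, h2⟩) h1
      · rintro ⟨i, rfl⟩
        exact ⟨i, by simp⟩
    obtain ⟨⟨κ, ζ⟩, hc⟩ := isConj_iff.1 hconj
    rw [mul_inv_eq_iff_eq_mul] at hc
    have hζ : ζ * β b = β b * ζ := congrArg SemidirectProduct.right hc
    have hprod := wreathProd_eq_of_conj (f := wreathMapBase α β f) (g := wreathMapBase α β g) hc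
    simp only [wreathProd_mapBase] at hprod
    -- The conjugator `ζ` carries the coset of `β t₁` here. The product of `f` there is unchanged by
    -- `E` and stays nontrivial by `D`, so `g` has a support point `s` over this coset.
    have h0 := hprod (ζ * β t₁)
    have h1 : wreathProd (β ⁻¹' {t | ζ * t ∈ cyclicCoset (β b) (ζ * β t₁)}) f =
        wreathProd (cyclicCoset b t₁) f := by
      refine wreathProd_congr fun t ht => ?_
      have h2 : ζ * β t * (ζ * β t₁)⁻¹ = ζ * β (t * t₁⁻¹) * ζ⁻¹ := by
        simp only [map_mul, map_inv]; group
      rw [Set.mem_preimage, Set.mem_ofPred_eq, mem_cyclicCoset, mem_cyclicCoset, h2,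
        conj_mem_zpowers hζ]
      exact hE' _ (Finset.mem_union_left _ (Finset.mem_image_of_mem _ (memF.2 ht)))
    rw [h1] at h0
    have h2 : wreathProd (β ⁻¹' cyclicCoset (β b) (ζ * β t₁)) g ≠ 1 := by
      intro h
      rw [h, map_one] at h0
      exact hD _ (Finset.mem_insert_self _ _) h0
    obtain ⟨s, hs, hgs⟩ := exists_of_wreathProd_ne_one h2
    -- Thus `ζ` agrees with the candidate `β (z s)` modulo `⟨β b⟩`, so `β (z s)` commutes with `β
    -- b`, and the coset of `r s` then gives a contradiction.
    have hzs : β (z s) * ζ⁻¹ ∈ Subgroup.zpowers (β b) := by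
      have : β s * (ζ * β t₁)⁻¹ ∈ Subgroup.zpowers (β b) := hs
      simpa [z, mul_assoc] using this
    have hcomm : β (z s) * β b = β b * β (z s) := by
      obtain ⟨i, hi⟩ := hzs
      have : β (z s) = β b ^ i * ζ := by
        simp only at hi
        rw [hi, inv_mul_cancel_right]
      rw [this]
      exact ((Commute.zpow_left (Commute.refl (β b)) i).mul_left hζ).eq
    have hzc : z s * b = b * z s := by
      by_contra hne
      refine hL (z s * b, b * z s) (Finset.mem_image_of_mem (fun s => (z s * b, b * z s))
        (Finset.mem_filter.2 ⟨memΓ.2 hgs, hne⟩)) ?_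
      simpa using hcomm
    have hsc : s ∈ Γc := memΓc.2 ⟨hgs, hzc⟩
    have h3 := hprod (β (r s))
    have h4 : wreathProd (β ⁻¹' {t | ζ * t ∈ cyclicCoset (β b) (β (r s))}) f =
        wreathProd {t | z s * t ∈ cyclicCoset b (r s)} f := by
      refine wreathProd_congr fun t ht => ?_
      rw [Set.mem_preimage, Set.mem_ofPred_eq, Set.mem_ofPred_eq, mem_cyclicCoset,
        mem_cyclicCoset, ← hE' _ (Finset.mem_union_right _ (Finset.mem_union_left _
          (Finset.mem_image_of_mem (fun p : B × B => z p.1 * p.2 * (r p.1)⁻¹)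
            (Finset.mk_mem_product hsc (memF.2 ht))))), ← Subgroup.mul_mem_cancel_left _ hzs]
      simp [mul_assoc]
    have h5 : wreathProd (β ⁻¹' cyclicCoset (β b) (β (r s))) g =
        wreathProd (cyclicCoset b (r s)) g := by
      refine wreathProd_congr fun t ht => ?_
      rw [Set.mem_preimage, mem_cyclicCoset,
        mem_cyclicCoset, ← hE' _ (Finset.mem_union_right _ (Finset.mem_union_right _
          (Finset.mem_image_of_mem (fun p : B × B => p.2 * (r p.1)⁻¹)
            (Finset.mk_mem_product hsc (memΓ.2 ht)))))]
      simp
    rw [h4, h5] at h3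
    refine hD _ (Finset.mem_insert_of_mem (Finset.mem_image_of_mem _ hsc)) ?_
    rw [map_mul, map_inv, mul_inv_eq_one]
    exact h3

/-- The situation is symmetric in `f` and `g`, so one nontrivial coset product of either suffices.
If there is none, `z = 1` already conjugates. -/
theorem exists_separating_data {lA : A → ℕ} {lB : B → ℕ} (hlA : IsLength lA)
    (hlB : IsLength lB) {f g : wreathBase A B} {b y w : B} {m k σ : ℕ}
    (hfm : (Function.mulSupport f.1).ncard ≤ m) (hgm : (Function.mulSupport g.1).ncard ≤ m)
    (hfB : ∀ t, f.1 t ≠ 1 → lB (y⁻¹ * t) ≤ k) (hgB : ∀ t, g.1 t ≠ 1 → lB (w⁻¹ * t) ≤ k)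
    (hfA : ∀ t, lA (f.1 t) ≤ k) (hgA : ∀ t, lA (g.1 t) ≤ k)
    (hy : lB (y⁻¹ * b * y) ≤ k) (hw : lB (w⁻¹ * b * w) ≤ k) (hσ : lB y + lB w ≤ σ)
    (hfg : ¬ IsConj (⟨f, b⟩ : RestrictedWreath A B) ⟨g, b⟩) :
    ∃ (E : Finset B) (L : Finset (B × B)) (D : Finset A),
      E.card ≤ m + 2 * m ^ 2 ∧ D.card ≤ m + 1 ∧
      (∀ e ∈ E, e ∉ Subgroup.zpowers b ∧
        ∃ p, lB (p⁻¹ * e * p) ≤ 4 * k ∧ lB (p⁻¹ * b * p) ≤ k) ∧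
      (∀ q ∈ L, q.1 ≠ q.2 ∧ lB q.1 ≤ σ + 3 * k ∧ lB q.2 ≤ σ + 3 * k) ∧
      (∀ d ∈ D, d ≠ 1 ∧ lA d ≤ 2 * (m * k)) ∧
      ∀ (A' B' : Type u) [CommGroup A'] [Group B'] (α : A →* A') (β : B →* B'),
        (∀ e ∈ E, β e ∉ Subgroup.zpowers (β b)) → (∀ q ∈ L, β q.1 ≠ β q.2) →
        (∀ d ∈ D, α d ≠ 1) → ¬ IsConj (wreathMap α β ⟨f, b⟩) (wreathMap α β ⟨g, b⟩) := by
  by_cases h1 : ∃ t, wreathProd (cyclicCoset b t) f ≠ 1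
  · obtain ⟨t, ht⟩ := h1
    exact exists_separating_data_of_ne_one hlA hlB hfm hgm hfB hgB hfA hgA hy hw hσ hfg ht
  by_cases h2 : ∃ t, wreathProd (cyclicCoset b t) g ≠ 1
  · obtain ⟨t, ht⟩ := h2
    obtain ⟨E, L, D, hE, hD, hE', hL', hD', hsep⟩ := exists_separating_data_of_ne_one hlA hlB
      hgm hfm hgB hfB hgA hfA hw hy ((add_comm _ _).trans_le hσ) (fun h => hfg h.symm) ht
    exact ⟨E, L, D, hE, hD, hE', hL', hD', fun A' B' _ _ α β h1 h2 h3 h =>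
      hsep A' B' α β h1 h2 h3 h.symm⟩
  push Not at h1 h2
  refine absurd (isConj_of_wreathProd_eq (z := 1) (by simp) fun r => ?_) hfg
  simp only [one_mul, Set.ofPred_mem_eq]
  rw [h1, h2]

end SeparatingData

/-! ### Finite `B`: powers in place of coset products. -/

section FiniteTop

variable {A A' B : Type u} [Group A] [Group A'] [Group B]

theorem wreath_mul_left_apply (x y : RestrictedWreath A B) (r : B) :
    (x * y).left.1 r = x.left.1 r * y.left.1 (x.right⁻¹ * r) := rfl

theorem wreath_pow_right (x : RestrictedWreath A B) (i : ℕ) : (x ^ i).right = x.right ^ i :=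
  map_pow SemidirectProduct.rightHom x i

/-- The `n`-th powers are conjugate by the same `c`, and `y ^ n` has trivial right coordinate, so
the relation becomes a conjugation in `A` at each point. -/
theorem isConj_pow_left_of_conj {x y c : RestrictedWreath A B} (h : c * x = y * c) {n : ℕ}
    (hy : y.right ^ n = 1) (r : B) :
    IsConj ((x ^ n).left.1 (c.right⁻¹ * r)) ((y ^ n).left.1 r) := by
  have h1 : c * x ^ n = y ^ n * c := SemiconjBy.pow_right (a := c) h n
  have h2 := congrArg (fun w : RestrictedWreath A B => w.left.1 r) h1
  simp only [wreath_mul_left_apply, wreath_pow_right, hy, inv_one, one_mul] at h2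
  exact isConj_iff.2 ⟨c.left.1 r, by rw [mul_inv_eq_iff_eq_mul, h2]⟩

theorem isConj_of_isConj_pow_left [Finite B] {f g : wreathBase A B} {b : B}
    (h : ∀ r, IsConj (((⟨f, b⟩ : RestrictedWreath A B) ^ orderOf b).left.1 r)
      (((⟨g, b⟩ : RestrictedWreath A B) ^ orderOf b).left.1 r)) :
    IsConj (⟨f, b⟩ : RestrictedWreath A B) ⟨g, b⟩ := by
  let x : RestrictedWreath A B := ⟨f, b⟩
  let y : RestrictedWreath A B := ⟨g, b⟩
  have h' : ∀ r, ∃ c, c * (x ^ orderOf b).left.1 r * c⁻¹ = (y ^ orderOf b).left.1 r :=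
    fun r => isConj_iff.1 (h r)
  choose c hc using h'
  let s := QuotientGroup.rightRel (Subgroup.zpowers b)
  let ρ : B → B := fun t => (Quotient.mk s t).out
  have hi : ∀ t, ∃ i : ℕ, b ^ i * t = ρ t := by
    intro t
    have h1 : t * (ρ t)⁻¹ ∈ Subgroup.zpowers b :=
      QuotientGroup.rightRel_apply.1 (Quotient.mk_out (s := s) t)
    rw [← inv_mem_iff, mul_inv_rev, inv_inv,
      ← (isOfFinOrder_of_finite b).mem_powers_iff_mem_zpowers] at h1
    obtain ⟨i, hi⟩ := h1
    exact ⟨i, by simp only at hi; rw [hi, inv_mul_cancel_right]⟩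
  choose i hi using hi
  have hρ : ∀ t, ρ (b⁻¹ * t) = ρ t := fun t => by
    refine congrArg Quotient.out (Quotient.sound (s := s) (QuotientGroup.rightRel_apply.2 ?_))
    simp
  -- A conjugator in the base is forced along an orbit by its value `c r` at the representative: `κ
  -- r j` is its value at `(b ^ j)⁻¹ * r`. The relation for `c r` makes it periodic in `j`, so it is
  -- well defined.
  let κ : B → ℕ → A := fun r j => ((y ^ j).left.1 r)⁻¹ * c r * (x ^ j).left.1 r
  have hper : ∀ r, Function.Periodic (κ r) (orderOf b) := by
    intro r j
    have h1 := hc r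
    rw [mul_inv_eq_iff_eq_mul] at h1
    simp only [κ, add_comm j, pow_add, wreath_mul_left_apply, wreath_pow_right]
    simp only [x, y, pow_orderOf_eq_one, inv_one, one_mul] at h1 ⊢
    rw [mul_inv_rev, mul_assoc, mul_assoc, ← mul_assoc (c r), h1]
    group
  have hκ : ∀ r j l, b ^ j = b ^ l → κ r j = κ r l := by
    intro r j l hjl
    rw [← (hper r).map_mod_nat j, ← (hper r).map_mod_nat l, pow_eq_pow_iff_modEq.1 hjl]
  let k : wreathBase A B := ⟨fun t => κ (ρ t) (i t), Set.toFinite _⟩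
  refine isConj_iff.2 ⟨⟨k, 1⟩, ?_⟩
  rw [mul_inv_eq_iff_eq_mul]
  refine SemidirectProduct.ext (wreathBase_ext fun t => ?_) ?_
  · change κ (ρ t) (i t) * f.1 (1⁻¹ * t) = g.1 t * κ (ρ (b⁻¹ * t)) (i (b⁻¹ * t))
    rw [hρ, inv_one, one_mul]
    have h1 : b ^ i (b⁻¹ * t) = b ^ (i t + 1) := by
      have h2 := hi (b⁻¹ * t)
      rw [hρ, ← hi t, ← mul_assoc] at h2
      have h3 := mul_right_cancel h2
      rw [pow_succ, ← h3, inv_mul_cancel_right]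
    rw [hκ _ _ _ h1]
    have h4 : (b ^ i t)⁻¹ * ρ t = t := by rw [← hi t, inv_mul_cancel_left]
    simp only [κ, pow_succ, wreath_mul_left_apply, wreath_pow_right, x, y, h4]
    group
  · change 1 * b = b * 1
    simp

/-- The homomorphism of wreath products over `B` induced by a homomorphism `A → A'`. -/
def wreathMapLeft (α : A →* A') : RestrictedWreath A B →* RestrictedWreath A' B :=
  SemidirectProduct.map
    { toFun := fun f => ⟨fun t => α (f.1 t), Set.Finite.subset f.2 fun t ht h =>
        ht (by simp only [h, map_one])⟩
      map_one' := wreathBase_ext fun _ => map_one α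
      map_mul' := fun _ _ => wreathBase_ext fun _ => map_mul α _ _ }
    (MonoidHom.id B) fun _ => rfl

theorem wreathMapLeft_left (α : A →* A') (x : RestrictedWreath A B) (t : B) :
    (wreathMapLeft α x).left.1 t = α (x.left.1 t) := rfl

theorem IsLength.wreath_pow_le {lA : A → ℕ} (hlA : IsLength lA) {k : ℕ}
    {x : RestrictedWreath A B} (hx : ∀ t, lA (x.left.1 t) ≤ k) (i : ℕ) (r : B) :
    lA ((x ^ i).left.1 r) ≤ i * k := by
  induction i with
  | zero =>
    rw [pow_zero]
    exact hlA.one.le.trans (Nat.zero_le _)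
  | succ i ih =>
    rw [pow_succ, wreath_mul_left_apply, add_mul, one_mul]
    exact (hlA.mul_le _ _).trans (Nat.add_le_add ih (hx _))

/-- Passing from `A` to `A'` leaves `B` alone, so a conjugator in the quotient has a right
coordinate `z` in `B`. One pair of values that fails to be conjugate for that `z` rules it out. -/
theorem exists_separating_pairs [Finite B] {lA : A → ℕ} (hlA : IsLength lA) {k : ℕ}
    {x y : RestrictedWreath A B} (hx : ∀ t, lA (x.left.1 t) ≤ k) (hy : ∀ t, lA (y.left.1 t) ≤ k)
    (hxy : ¬ IsConj x y) :
    ∃ D : Finset (A × A), D.card ≤ Nat.card B ∧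
      (∀ d ∈ D, ¬ IsConj d.1 d.2 ∧ lA d.1 ≤ Nat.card B * k ∧ lA d.2 ≤ Nat.card B * k) ∧
      ∀ (A' : Type u) [Group A'] (α : A →* A'), (∀ d ∈ D, ¬ IsConj (α d.1) (α d.2)) →
        ¬ IsConj (wreathMapLeft (B := B) α x) (wreathMapLeft α y) := by
  classical
  have := Fintype.ofFinite B
  let n := orderOf x.right
  have hn : n ≤ Nat.card B := by
    rw [Nat.card_eq_fintype_card]
    exact orderOf_le_card_univ
  have hr : ∀ z : B, z * x.right * z⁻¹ = y.right →
      ∃ r, ¬ IsConj ((x ^ n).left.1 (z⁻¹ * r)) ((y ^ n).left.1 r) := by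
    intro z hz
    by_contra! hcon
    apply hxy
    let c : RestrictedWreath A B := ⟨1, z⟩
    have h1 : IsConj x (c * x * c⁻¹) := isConj_iff.2 ⟨c, rfl⟩
    refine h1.trans ?_
    have h2 : c * x * c⁻¹ = ⟨wreathAction A B z x.left, y.right⟩ := by
      rw [mul_inv_eq_iff_eq_mul]
      refine SemidirectProduct.ext ?_ ?_
      · change 1 * wreathAction A B z x.left =
          wreathAction A B z x.left * wreathAction A B y.right 1
        rw [one_mul, map_one, mul_one]
      · change z * x.right = y.right * z
        rw [← hz, inv_mul_cancel_right]
    have hord : orderOf y.right = n := by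
      rw [← hz]
      exact orderOf_injective (MulAut.conj z).toMonoidHom (MulAut.conj z).injective _
    rw [h2]
    refine isConj_of_isConj_pow_left (g := y.left) fun r => ?_
    rw [← h2, hord, conj_pow]
    have h3 : (c * x ^ n * c⁻¹).left.1 r = (x ^ n).left.1 (z⁻¹ * r) := by
      rw [wreath_mul_left_apply, wreath_mul_left_apply]
      change 1 * _ * (1 : A)⁻¹ = _
      rw [one_mul, inv_one, mul_one]
    rw [h3]
    exact hcon r
  choose! r hr using hr
  refine ⟨(Finset.univ.filter fun z : B => z * x.right * z⁻¹ = y.right).image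
    fun z => ((x ^ n).left.1 (z⁻¹ * r z), (y ^ n).left.1 (r z)), ?_, ?_, ?_⟩
  · rw [Nat.card_eq_fintype_card]
    exact Finset.card_image_le.trans (Finset.card_le_univ _)
  · intro d hd
    obtain ⟨z, hz, rfl⟩ := Finset.mem_image.1 hd
    exact ⟨hr z (Finset.mem_filter.1 hz).2,
      (hlA.wreath_pow_le hx n _).trans (Nat.mul_le_mul_right _ hn),
      (hlA.wreath_pow_le hy n _).trans (Nat.mul_le_mul_right _ hn)⟩
  · intro A' _ α hD hconj
    obtain ⟨c, hc⟩ := isConj_iff.1 hconj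
    have hz : c.right * x.right * c.right⁻¹ = y.right := congrArg SemidirectProduct.right hc
    rw [mul_inv_eq_iff_eq_mul] at hc
    refine hD _ (Finset.mem_image_of_mem _ (Finset.mem_filter.2 ⟨Finset.mem_univ c.right, hz⟩)) ?_
    have h1 := isConj_pow_left_of_conj hc (n := n) (by
      change y.right ^ n = 1
      rw [← hz, conj_pow, pow_orderOf_eq_one, mul_one, mul_inv_cancel]) (r c.right)
    rwa [← map_pow, ← map_pow, wreathMapLeft_left, wreathMapLeft_left] at h1

variable {C : GroupClass.{u}}

theorem IsConjugacySeparable.wreath_of_mem (hC : IsExtensionClosedPseudovariety C)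
    (hA : IsConjugacySeparable C A) (hB : C B) :
    IsConjugacySeparable C (RestrictedWreath A B) := by
  intro x y hxy
  have := hC.finite _ hB
  obtain ⟨D, -, hD, hsep⟩ := exists_separating_pairs (k := 0) isLength_zero (x := x) (y := y)
    (fun _ => le_rfl) (fun _ => le_rfl) hxy
  obtain ⟨N, ⟨hn, hN⟩, hND⟩ := exists_isCoClass_forall' hC D
    (fun d N => SeparatedBy N (conjugatesOf d.1) d.2) (fun _ _ _ hle h => h.mono hle)
    fun d hd => hA d.1 d.2 (hD d hd).1
  exact ⟨_, IsCoClass.ker hC _ (hC.restrictedWreath hN hB), separatedBy_conj_of_hom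
    (hsep _ (QuotientGroup.mk' N) fun d hd => not_isConj_mk_of_separatedBy (hND d hd))⟩

end FiniteTop

/-! ### Sufficiency in the abelian case. -/

section Separability

variable {A B : Type u} [Group B] {C : GroupClass.{u}}

theorem SeparatedBy.mk_notMem_zpowers {M : Subgroup B} [M.Normal] {b e : B}
    (h : SeparatedBy M (Subgroup.zpowers b : Set B) e) :
    QuotientGroup.mk' M e ∉ Subgroup.zpowers (QuotientGroup.mk' M b) := by
  rintro ⟨i, hi⟩
  exact h ⟨b ^ i, ⟨i, rfl⟩, hi⟩

/-- A normal subgroup separates a pair as soon as it separates a simultaneous conjugate, so cyclic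
depth can be measured on short conjugates. -/
theorem SeparatedBy.of_conj_zpowers {M : Subgroup B} (hM : M.Normal) {b e p : B}
    (h : SeparatedBy M (Subgroup.zpowers (p⁻¹ * b * p) : Set B) (p⁻¹ * e * p)) :
    SeparatedBy M (Subgroup.zpowers b : Set B) e := by
  rw [separatedBy_iff] at *
  rintro _ ⟨i, rfl⟩ hm
  have h1 : (p⁻¹ * b * p) ^ i = p⁻¹ * b ^ i * p := by
    simpa using conj_zpow (i := i) (a := p⁻¹) (b := b)
  refine h _ ⟨i, rfl⟩ ?_
  have := hM.conj_mem _ hm p⁻¹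
  simp only [h1]
  convert! this using 1
  group

theorem notMem_zpowers_conj {b e : B} (h : e ∉ Subgroup.zpowers b) (p : B) :
    p⁻¹ * e * p ∉ Subgroup.zpowers (p⁻¹ * b * p) := by
  rintro ⟨i, hi⟩
  have h1 : (p⁻¹ * b * p) ^ i = p⁻¹ * b ^ i * p := by
    simpa using conj_zpow (i := i) (a := p⁻¹) (b := b)
  simp only [h1] at hi
  exact h ⟨i, mul_left_cancel (mul_right_cancel hi)⟩

/-- Conjugating by `z` equalizes the right coordinates but moves the support of `f` by up to the
length of `z`. With base points `z⁻¹` and `1` in `exists_separating_data`, that length enters only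
the bound for `L`. -/
theorem exists_separating_data_of_conj [CommGroup A] {lA : A → ℕ} {lB : B → ℕ}
    (hlA : IsLength lA) (hlB : IsLength lB) {f g : wreathBase A B} {b c z : B} {m k : ℕ}
    (hfm : (Function.mulSupport f.1).ncard ≤ m) (hgm : (Function.mulSupport g.1).ncard ≤ m)
    (hfB : ∀ t, f.1 t ≠ 1 → lB t ≤ k) (hgB : ∀ t, g.1 t ≠ 1 → lB t ≤ k)
    (hfA : ∀ t, lA (f.1 t) ≤ k) (hgA : ∀ t, lA (g.1 t) ≤ k)
    (hb : lB b ≤ k) (hc : lB c ≤ k) (hz : z⁻¹ * b * z = c)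
    (hfg : ¬ IsConj (⟨f, b⟩ : RestrictedWreath A B) ⟨g, c⟩) :
    ∃ (E : Finset B) (L : Finset (B × B)) (D : Finset A),
      E.card ≤ m + 2 * m ^ 2 ∧ D.card ≤ m + 1 ∧
      (∀ e ∈ E, e ∉ Subgroup.zpowers c ∧
        ∃ p, lB (p⁻¹ * e * p) ≤ 4 * k ∧ lB (p⁻¹ * c * p) ≤ k) ∧
      (∀ q ∈ L, q.1 ≠ q.2 ∧ lB q.1 ≤ lB z + 3 * k ∧ lB q.2 ≤ lB z + 3 * k) ∧
      (∀ d ∈ D, d ≠ 1 ∧ lA d ≤ 2 * (m * k)) ∧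
      ∀ (A' B' : Type u) [CommGroup A'] [Group B'] (α : A →* A') (β : B →* B'),
        (∀ e ∈ E, β e ∉ Subgroup.zpowers (β c)) → (∀ q ∈ L, β q.1 ≠ β q.2) →
        (∀ d ∈ D, α d ≠ 1) → ¬ IsConj (wreathMap α β ⟨f, b⟩) (wreathMap α β ⟨g, c⟩) := by
  have hconj : IsConj (⟨wreathAction A B z⁻¹ f, c⟩ : RestrictedWreath A B) ⟨f, b⟩ := by
    refine isConj_iff.2 ⟨⟨1, z⟩, ?_⟩
    rw [mul_inv_eq_iff_eq_mul]
    refine SemidirectProduct.ext ?_ ?_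
    · change 1 * wreathAction A B z (wreathAction A B z⁻¹ f) = f * wreathAction A B b 1
      rw [← MulAut.mul_apply, ← map_mul]
      simp
    · change z * c = b * z
      rw [← hz]
      group
  have hval : ∀ t, (wreathAction A B z⁻¹ f).1 t = f.1 (z * t) := fun t => by
    rw [wreathAction_apply, inv_inv]
  have hm : (Function.mulSupport (wreathAction A B z⁻¹ f).1).ncard ≤ m := by
    refine le_trans ?_ hfm
    refine Set.ncard_le_ncard_of_injOn (fun t => z * t) (fun t ht => ?_)
      (mul_right_injective z).injOn f.2
    rwa [Function.mem_mulSupport, hval] at ht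
  have hpos : ∀ t, (wreathAction A B z⁻¹ f).1 t ≠ 1 → lB (z⁻¹⁻¹ * t) ≤ k := by
    intro t ht
    rw [inv_inv]
    rw [hval] at ht
    exact hfB _ ht
  have hbz : z⁻¹⁻¹ * c * z⁻¹ = b := by rw [← hz]; group
  have hlen : lB z⁻¹ + lB 1 ≤ lB z := by
    rw [hlB.one]
    exact hlB.inv_le z
  obtain ⟨E, L, D, hE, hD, hE', hL', hD', hsep⟩ := exists_separating_data hlA hlB
    (f := wreathAction A B z⁻¹ f) (g := g) (b := c) (y := z⁻¹) (w := 1) hm hgm hpos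
    (by simpa using hgB) (fun t => (congrArg lA (hval t)).trans_le (hfA _)) hgA
    ((congrArg lB hbz).trans_le hb) (by simpa using hc) hlen
    (fun h => hfg (hconj.symm.trans h))
  refine ⟨E, L, D, hE, hD, hE', hL', hD', fun A' B' _ _ α β h1 h2 h3 h => ?_⟩
  exact hsep A' B' α β h1 h2 h3 (((wreathMap α β).map_isConj hconj).trans h)

theorem exists_separating_right {A : Type u} [Group A] (hC : IsExtensionClosedPseudovariety C)
    {x y : RestrictedWreath A B} {N : Subgroup B} (hN : IsCoClass C N)
    (hs : SeparatedBy N (conjugatesOf x.right) y.right) :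
    IsCoClass C (N.comap (SemidirectProduct.rightHom : RestrictedWreath A B →* B)) ∧
    SeparatedBy (N.comap (SemidirectProduct.rightHom : RestrictedWreath A B →* B))
      (conjugatesOf x) y := by
  refine ⟨hN.comap hC _, separatedBy_iff.2 fun w hw hm => ?_⟩
  exact separatedBy_iff.1 hs w.right (SemidirectProduct.rightHom.map_isConj hw) hm

theorem IsConjugacySeparable.wreath_of_comm [CommGroup A] (hC : IsExtensionClosedPseudovariety C)
    (hA : IsConjugacySeparable C A) (hB : IsConjugacySeparable C B)
    (hcyc : IsCyclicSubgroupSeparable C B) :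
    IsConjugacySeparable C (RestrictedWreath A B) := by
  intro x y hxy
  by_cases hr : IsConj x.right y.right
  · obtain ⟨z, hz⟩ := isConj_iff.1 hr
    obtain ⟨E, L, D, -, -, hE, hL, hD, hsep⟩ := exists_separating_data_of_conj (f := x.left)
      (g := y.left) (b := x.right) (c := y.right) (z := z⁻¹) (k := 0)
      (m := max (Function.mulSupport x.left.1).ncard (Function.mulSupport y.left.1).ncard)
      isLength_zero isLength_zero (le_max_left _ _) (le_max_right _ _) (fun _ _ => le_rfl)
      (fun _ _ => le_rfl) (fun _ => le_rfl) (fun _ => le_rfl) le_rfl le_rfl (by simpa using hz) hxy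
    obtain ⟨M₁, hM₁, h1⟩ := exists_isCoClass_forall' hC E
      (fun e M => SeparatedBy M (Subgroup.zpowers y.right : Set B) e)
      (fun _ _ _ hle h => h.mono hle) fun e he => hcyc _ e (hE e he).1
    obtain ⟨M₂, hM₂, h2⟩ := exists_isCoClass_forall' hC L
      (fun q M => q.1⁻¹ * q.2 ∉ M) (fun _ _ _ hle h hm => h (hle hm)) fun q hq =>
        hB.exists_notMem (fun h => (hL q hq).1 (inv_mul_eq_one.1 h))
    obtain ⟨N, ⟨hn, hN⟩, h3⟩ := exists_isCoClass_forall' hC D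
      (fun d N => d ∉ N) (fun _ _ _ hle h hm => h (hle hm)) fun d hd =>
        hA.exists_notMem (hD d hd).1
    obtain ⟨hm, hM⟩ := hM₁.inf hC hM₂
    refine ⟨_, IsCoClass.ker hC (wreathMap (QuotientGroup.mk' N) (QuotientGroup.mk' (M₁ ⊓ M₂)))
      (hC.restrictedWreath hN hM), separatedBy_conj_of_hom (hsep _ _ _ _ ?_ ?_ ?_)⟩
    · exact fun e he => ((h1 e he).mono inf_le_left).mk_notMem_zpowers
    · exact fun q hq h => h2 q hq (QuotientGroup.eq.1 h).2
    · exact fun d hd h => h3 d hd ((QuotientGroup.eq_one_iff d).1 h)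
  · obtain ⟨N, hN, hs⟩ := hB _ _ hr
    exact ⟨_, exists_separating_right hC hN hs⟩

end Separability

/-! ### Necessity of the conditions on `A` and `B`. -/

section Necessity

variable {A B : Type u} [Group B] {C : GroupClass.{u}}

theorem inl_wreathSingle_conj [Group A] (b t : B) (a : A) :
    (SemidirectProduct.inr b * SemidirectProduct.inl (wreathSingle t a) *
      (SemidirectProduct.inr b)⁻¹ : RestrictedWreath A B) =
      SemidirectProduct.inl (wreathSingle (b * t) a) := by
  rw [← wreathAction_single, SemidirectProduct.inl_aut, map_inv]

theorem IsCoClass.comap_inr [Group A] (hC : IsExtensionClosedPseudovariety C)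
    {N : Subgroup (RestrictedWreath A B)} (hN : IsCoClass C N) :
    IsCoClass C (N.comap (SemidirectProduct.inr : B →* RestrictedWreath A B)) :=
  hN.comap hC _

/-- As `B` is not in `C`, a co-`C` subgroup contains some `b ≠ 1` of `B`. Modulo it the summands at
`1` and `b` are identified, but they commute, so no commutator of `A` survives in any `C`-quotient.
-/
theorem IsConjugacySeparable.comm_of_wreath [Group A] (hC : IsExtensionClosedPseudovariety C)
    (h : IsConjugacySeparable C (RestrictedWreath A B)) (hB : ¬ C B) (x y : A) :
    x * y = y * x := by
  by_contra hne
  have h1 : (SemidirectProduct.inl (wreathSingle 1 (x * y * x⁻¹ * y⁻¹)) :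
      RestrictedWreath A B) ≠ 1 := by
    intro h0
    have h2 := congrArg (fun w : RestrictedWreath A B => w.left.1 1) h0
    simp only [SemidirectProduct.left_inl, wreathSingle_apply] at h2
    change x * y * x⁻¹ * y⁻¹ = 1 at h2
    rw [mul_inv_eq_one, mul_inv_eq_iff_eq_mul] at h2
    exact hne h2
  obtain ⟨N, hN, hn⟩ := h.exists_notMem h1
  obtain ⟨_, hM⟩ := hN.comap_inr hC
  have hM1 : N.comap (SemidirectProduct.inr : B →* RestrictedWreath A B) ≠ ⊥ := by
    intro h0
    refine hB (hC.of_injective (QuotientGroup.mk' _) ?_ hM)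
    rw [← MonoidHom.ker_eq_bot_iff, QuotientGroup.ker_mk', h0]
  obtain ⟨b, hb, hb1⟩ := (Subgroup.ne_bot_iff_exists_ne_one.1 hM1).elim fun b hb =>
    (⟨b.1, b.2, fun h => hb (Subtype.ext h)⟩ : ∃ b : B,
      b ∈ N.comap (SemidirectProduct.inr : B →* RestrictedWreath A B) ∧ b ≠ 1)
  obtain ⟨hNn, -⟩ := hN
  apply hn
  rw [← QuotientGroup.eq_one_iff]
  let π := QuotientGroup.mk' N
  have hπb : π (SemidirectProduct.inr b) = 1 := (QuotientGroup.eq_one_iff _).2 hb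
  have hshift : π (SemidirectProduct.inl (wreathSingle 1 y)) =
      π (SemidirectProduct.inl (wreathSingle b y)) := by
    have := inl_wreathSingle_conj b 1 y
    rw [mul_one] at this
    rw [← this]
    simp [hπb]
  have hcomm : wreathSingle (1 : B) x * wreathSingle b y =
      wreathSingle b y * wreathSingle 1 x := by
    refine wreathBase_ext fun t => ?_
    change (wreathSingle (1 : B) x).1 t * (wreathSingle b y).1 t =
      (wreathSingle b y).1 t * (wreathSingle (1 : B) x).1 t
    rw [wreathSingle_apply, wreathSingle_apply]
    split_ifs with h1 h2
    · exact absurd (h2.symm.trans h1) hb1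
    all_goals simp
  change π _ = 1
  simp only [map_mul, map_inv]
  rw [mul_inv_eq_one, mul_inv_eq_iff_eq_mul, hshift, ← map_mul, ← map_mul, hcomm, map_mul, map_mul]

theorem IsConjugacySeparable.cyclic_of_wreath [CommGroup A] [Nontrivial A]
    (hC : IsExtensionClosedPseudovariety C)
    (h : IsConjugacySeparable C (RestrictedWreath A B)) : IsCyclicSubgroupSeparable C B := by
  classical
  intro g e he
  by_contra! hcon
  obtain ⟨a, ha⟩ := exists_ne (1 : A)
  -- The value `a` at `1` and `a⁻¹` at `s` cancel in the coset products exactly when `s` lies in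
  -- `⟨g⟩`. A quotient that does not separate `e` from `⟨g⟩` identifies `u e` with such a `u s`.
  let u : B → wreathBase A B := fun s => wreathSingle 1 a * (wreathSingle s a)⁻¹
  have hnc : ¬ IsConj (⟨1, g⟩ : RestrictedWreath A B) ⟨u e, g⟩ := by
    intro hc
    obtain ⟨c, hc⟩ := isConj_iff.1 hc
    rw [mul_inv_eq_iff_eq_mul] at hc
    have h1 := wreathProd_eq_of_conj (k := c.left) (z := c.right) hc 1
    rw [map_one, map_mul, map_inv, wreathProd_single, wreathProd_single,
      if_pos (by simp [mem_cyclicCoset]), if_neg (by simpa [mem_cyclicCoset] using he)] at h1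
    exact ha (by simpa using h1.symm)
  obtain ⟨N, hN, hs⟩ := h _ _ hnc
  have hM := hN.comap_inr hC
  obtain ⟨hNn, -⟩ := hN
  have hns := hcon _ hM
  rw [separatedBy_iff] at hns
  push Not at hns
  obtain ⟨s, hsg, hse⟩ := hns
  have hconj : IsConj (⟨1, g⟩ : RestrictedWreath A B) ⟨u s, g⟩ := by
    refine isConj_of_wreathProd_eq (z := 1) (by simp) fun r => ?_
    rw [map_one, map_mul, map_inv, wreathProd_single, wreathProd_single]
    have : (1 : B) ∈ cyclicCoset g r ↔ s ∈ cyclicCoset g r := by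
      rw [mem_cyclicCoset, mem_cyclicCoset, Subgroup.mul_mem_cancel_left _ hsg, one_mul]
    simp only [this, mul_inv_cancel]
  refine not_isConj_mk_of_separatedBy hs ?_
  have hmk : QuotientGroup.mk' N (⟨u s, g⟩ : RestrictedWreath A B) =
      QuotientGroup.mk' N ⟨u e, g⟩ := by
    have hse' : QuotientGroup.mk' N (SemidirectProduct.inr s) =
        QuotientGroup.mk' N (SemidirectProduct.inr e) := by
      refine QuotientGroup.eq.2 ?_
      rwa [← map_inv, ← map_mul]
    have hsingle : QuotientGroup.mk' N (SemidirectProduct.inl (wreathSingle s a)) =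
        QuotientGroup.mk' N (SemidirectProduct.inl (wreathSingle e a)) := by
      have h1 := inl_wreathSingle_conj s 1 a
      have h2 := inl_wreathSingle_conj e 1 a
      rw [mul_one] at h1 h2
      rw [← h1, ← h2]
      simp only [map_mul, map_inv, hse']
    have hdec : ∀ s, (⟨u s, g⟩ : RestrictedWreath A B) =
        SemidirectProduct.inl (wreathSingle 1 a) *
          (SemidirectProduct.inl (wreathSingle s a))⁻¹ * SemidirectProduct.inr g := by
      intro s
      rw [← map_inv, ← map_mul, ← SemidirectProduct.mk_eq_inl_mul_inr]
    rw [hdec, hdec]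
    simp only [map_mul, map_inv, hsingle]
  rw [← hmk]
  exact (QuotientGroup.mk' N).map_isConj hconj

end Necessity

/-! ### Word length in the wreath product controls both coordinates linearly. -/

section WreathLength

variable {A B : Type u} [Group A] [Group B]

/-- Both coordinates of a wreath product element have size at most `k` with respect to the given
length functions. -/
structure WreathSizeLE (lA : A → ℕ) (lB : B → ℕ) (k : ℕ) (x : RestrictedWreath A B) : Prop where
  support : (Function.mulSupport x.left.1).ncard ≤ k
  position : ∀ t, x.left.1 t ≠ 1 → lB t ≤ k
  value : ∀ t, lA (x.left.1 t) ≤ k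
  right : lB x.right ≤ k

theorem WreathSizeLE.mono {lA : A → ℕ} {lB : B → ℕ} {k l : ℕ} {x : RestrictedWreath A B}
    (h : WreathSizeLE lA lB k x) (hkl : k ≤ l) : WreathSizeLE lA lB l x :=
  ⟨h.support.trans hkl, fun t ht => (h.position t ht).trans hkl, fun t => (h.value t).trans hkl,
    h.right.trans hkl⟩

theorem wreathSizeLE_one {lA : A → ℕ} {lB : B → ℕ} (hlA : IsLength lA) (hlB : IsLength lB) :
    WreathSizeLE lA lB 0 (1 : RestrictedWreath A B) := by
  refine ⟨?_, fun t ht => (ht rfl).elim, fun t => hlA.one.le, hlB.one.le⟩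
  have : Function.mulSupport (1 : RestrictedWreath A B).left.1 = ∅ := Function.mulSupport_one
  rw [this, Set.ncard_empty]

theorem WreathSizeLE.mul {lA : A → ℕ} {lB : B → ℕ} (hlA : IsLength lA) (hlB : IsLength lB)
    {k l : ℕ} {x y : RestrictedWreath A B} (hx : WreathSizeLE lA lB k x)
    (hy : WreathSizeLE lA lB l y) : WreathSizeLE lA lB (k + l) (x * y) := by
  have hsupp : ∀ t, (x * y).left.1 t ≠ 1 → x.left.1 t ≠ 1 ∨ y.left.1 (x.right⁻¹ * t) ≠ 1 := by
    intro t ht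
    rw [wreath_mul_left_apply] at ht
    by_contra! h
    exact ht (by rw [h.1, h.2, one_mul])
  refine ⟨?_, ?_, ?_, ?_⟩
  · have hfin : (Function.mulSupport x.left.1 ∪
        (fun t => x.right * t) '' Function.mulSupport y.left.1).Finite :=
      Set.Finite.union x.left.2 (Set.Finite.image _ y.left.2)
    refine (Set.ncard_le_ncard ?_ hfin).trans ((Set.ncard_union_le _ _).trans
      (Nat.add_le_add hx.support ((Set.ncard_image_le y.left.2).trans hy.support)))
    intro t ht
    rcases hsupp t ht with h | h
    · exact Or.inl h
    · exact Or.inr ⟨_, h, mul_inv_cancel_left _ _⟩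
  · intro t ht
    rcases hsupp t ht with h | h
    · exact (hx.position t h).trans (Nat.le_add_right _ _)
    · have h1 := hlB.mul_le x.right (x.right⁻¹ * t)
      rw [mul_inv_cancel_left] at h1
      exact h1.trans (Nat.add_le_add hx.right (hy.position _ h))
  · intro t
    rw [wreath_mul_left_apply]
    exact (hlA.mul_le _ _).trans (Nat.add_le_add (hx.value _) (hy.value _))
  · exact (hlB.mul_le x.right y.right).trans (Nat.add_le_add hx.right hy.right)

theorem exists_wreathSizeLE {lA : A → ℕ} {lB : B → ℕ} (hlA : IsLength lA)
    (x : RestrictedWreath A B) : ∃ k, WreathSizeLE lA lB k x := by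
  have hf : (Function.mulSupport x.left.1).Finite := x.left.2
  let F := hf.toFinset
  refine ⟨(Function.mulSupport x.left.1).ncard + F.sup lB + F.sup (fun t => lA (x.left.1 t)) +
    lB x.right, ⟨by omega, fun t ht => ?_, fun t => ?_, by omega⟩⟩
  · have := Finset.le_sup (f := lB) (hf.mem_toFinset.2 ht)
    change lB t ≤ F.sup lB at this
    omega
  · by_cases ht : x.left.1 t = 1
    · rw [ht, hlA.one]
      exact Nat.zero_le _
    · have := Finset.le_sup (f := fun t => lA (x.left.1 t)) (hf.mem_toFinset.2 ht)
      change lA (x.left.1 t) ≤ F.sup (fun t => lA (x.left.1 t)) at this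
      omega

theorem Generates.exists_wreathSizeLE {S : Finset (RestrictedWreath A B)} (hS : Generates S)
    {lA : A → ℕ} {lB : B → ℕ} (hlA : IsLength lA) (hlB : IsLength lB) :
    ∃ K, ∀ n x, wordLength S x ≤ n → WreathSizeLE lA lB (K * n) x := by
  choose κ hκ using _root_.exists_wreathSizeLE (lB := lB) hlA (B := B)
  -- Words use inverses of generators as well; the sum dominates the sizes of both.
  refine ⟨S.sup fun s => κ s + κ s⁻¹, fun n x hx => ?_⟩
  refine WreathSizeLE.mono ?_ (Nat.mul_le_mul_left _ hx)
  refine hS.induction_wordLength (p := fun n x =>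
    WreathSizeLE lA lB ((S.sup fun s => κ s + κ s⁻¹) * n) x) ?_ ?_ x
  · exact wreathSizeLE_one hlA hlB
  · intro n g s hs ih
    rw [mul_add, mul_one]
    refine ih.mul hlA hlB ((hκ s).mono ?_)
    rcases hs with hs | hs
    · have := Finset.le_sup (f := fun s => κ s + κ s⁻¹) hs
      omega
    · have := Finset.le_sup (f := fun s => κ s + κ s⁻¹) hs
      simp only [inv_inv] at this
      omega

end WreathLength

/-! ### The upper bounds for the conjugacy separability function. -/

section Bounds

variable {A B : Type u} [Group B] {C : GroupClass.{u}}

theorem asympLE_conjFun_of_mem [Group A] (hC : IsExtensionClosedPseudovariety C)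
    (hA : IsConjugacySeparable C A) (hB : C B) {SA : Finset A}
    {SG : Finset (RestrictedWreath A B)} (hSA : Generates SA) (hSG : Generates SG) :
    AsympLE (conjFun C SG) (fun n => conjFun C SA n ^ (Nat.card B ^ 3)) := by
  have := hC.finite _ hB
  have hpos : 0 < Nat.card B := Nat.card_pos
  obtain ⟨K, hK⟩ := hSG.exists_wreathSizeLE hSA.isLength (isLength_zero (G := B))
  -- Taking a power up to the order of an element of `B` multiplies lengths in `A` by at most `|B|`;
  -- the same constant absorbs the factor `|B|` in the order of the wreath product.
  refine ⟨Nat.card B * (K + 1), fun n => ?_⟩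
  have h1 := one_le_conjFun (C := C) SA (Nat.card B * (K + 1) * n)
  refine conjFun_le (Nat.mul_pos (by positivity) (Nat.pow_pos h1)) fun x y hxy hx hy => ?_
  obtain ⟨D, hDc, hD, hsep⟩ := exists_separating_pairs hSA.isLength (hK n x hx).value
    (hK n y hy).value hxy
  have hle : Nat.card B * (K * n) ≤ Nat.card B * (K + 1) * n := by
    rw [mul_assoc]
    gcongr
    omega
  obtain ⟨N, ⟨hn, hN⟩, hNi, hND⟩ := exists_isCoClass_forall hC D
    (fun d N => SeparatedBy N (conjugatesOf d.1) d.2) (fun _ _ _ hle h => h.mono hle)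
    (conjFun C SA (Nat.card B * (K + 1) * n)) fun d hd => by
      obtain ⟨N, hN, hs, hi⟩ := exists_index_eq_depth (hA d.1 d.2 (hD d hd).1)
      refine ⟨N, hN, hi.trans_le ?_, hs⟩
      exact depth_le_conjFun hSA (hD d hd).1 ((hD d hd).2.1.trans hle) ((hD d hd).2.2.trans hle)
  have := hC.finite _ hN
  refine (depth_conj_le_of_hom hC (wreathMapLeft (QuotientGroup.mk' N))
    (hC.restrictedWreath hN hB) (hsep _ (QuotientGroup.mk' N) fun d hd =>
      not_isConj_mk_of_separatedBy (hND d hd))).trans ?_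
  refine card_restrictedWreath_le.trans ?_
  rw [mul_comm]
  refine Nat.mul_le_mul (Nat.le_mul_of_pos_right _ (by omega)) ?_
  change N.index ^ Nat.card B ≤ _
  calc N.index ^ Nat.card B
      ≤ ((conjFun C SA (Nat.card B * (K + 1) * n)) ^ Nat.card B) ^ Nat.card B :=
        Nat.pow_le_pow_left (hNi.trans (Nat.pow_le_pow_right h1 hDc)) _
    _ = conjFun C SA (Nat.card B * (K + 1) * n) ^ (Nat.card B ^ 2) := by
        rw [← pow_mul, pow_two]
    _ ≤ _ := Nat.pow_le_pow_right h1 (Nat.pow_le_pow_right hpos (by norm_num))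

/-- There are at most `k + 2k² ≤ Φ(4k)²` cyclic separations, each between elements of length at most
`4k` after conjugation. The pairs in `L` have length at most `Short + 3k ≤ Φ(4k)`, so one subgroup
injective on that ball handles all of them. -/
theorem exists_quotient_of_isConj_right [CommGroup A] (hC : IsExtensionClosedPseudovariety C)
    (hB : IsConjugacySeparable C B) (hcyc : IsCyclicSubgroupSeparable C B)
    {lA : A → ℕ} (hlA : IsLength lA) {SB : Finset B} (hSB : Generates SB) {k : ℕ}
    {x y : RestrictedWreath A B} (hx : WreathSizeLE lA (wordLength SB) k x)
    (hy : WreathSizeLE lA (wordLength SB) k y) (hr : IsConj x.right y.right)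
    (hxy : ¬ IsConj x y) :
    ∃ (M : Subgroup B) (_ : M.Normal) (D : Finset A), C (B ⧸ M) ∧ M.index ≤ psiFun C SB (4 * k) ∧
      D.card ≤ k + 1 ∧ (∀ d ∈ D, d ≠ 1 ∧ lA d ≤ 2 * (k * k)) ∧
      ∀ (A' : Type u) [CommGroup A'] (α : A →* A'), (∀ d ∈ D, α d ≠ 1) →
        ¬ IsConj (wreathMap α (QuotientGroup.mk' M) x) (wreathMap α (QuotientGroup.mk' M) y) := by
  obtain ⟨z, hz, hzl⟩ := exists_conj_wordLength_le hSB hr hx.right hy.right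
  obtain ⟨E, L, D, hEc, hDc, hE, hL, hD, hsep⟩ := exists_separating_data_of_conj (f := x.left)
    (g := y.left) hlA hSB.isLength hx.support hy.support hx.position hy.position hx.value hy.value
    hx.right hy.right hz hxy
  have hzl' : wordLength SB z ≤ shortFun SB (4 * k) :=
    hzl.trans (shortFun_mono hSB (by omega))
  have hphi : 4 * k ≤ phiFun SB (4 * k) := Nat.le_add_left _ _
  have hsq : k + 2 * k ^ 2 ≤ phiFun SB (4 * k) ^ 2 := by nlinarith [Nat.le_self_pow two_ne_zero k]
  obtain ⟨M₁, hM₁, hi₁, h1⟩ := exists_isCoClass_forall hC E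
    (fun e M => SeparatedBy M (Subgroup.zpowers y.right : Set B) e)
    (fun _ _ _ hle h => h.mono hle) (cyclicFun C SB (phiFun SB (4 * k))) fun e he => by
      obtain ⟨hne, p, hp1, hp2⟩ := hE e he
      have hne' := notMem_zpowers_conj hne p
      obtain ⟨M, hM, hs, hi⟩ := exists_index_eq_depth (hcyc _ _ hne')
      exact ⟨M, hM, hi.trans_le (depth_le_cyclicFun hSB hne' (hp2.trans (by omega))
        (hp1.trans hphi)), hs.of_conj_zpowers hM.1⟩
  obtain ⟨M₂, hM₂, hinj, hi₂⟩ := exists_index_eq_residualGirth hC hSB hB (phiFun SB (4 * k))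
  obtain ⟨hm, hM⟩ := hM₂.inf hC hM₁
  refine ⟨M₂ ⊓ M₁, hm, D, hM, ?_, hDc, hD, fun A' _ α hα => hsep _ _ α _ ?_ ?_ hα⟩
  · refine Subgroup.index_inf_le.trans (Nat.mul_le_mul hi₂.le (hi₁.trans ?_))
    exact Nat.pow_le_pow_right (one_le_cyclicFun _ _) (hEc.trans hsq)
  · exact fun e he => ((h1 e he).mono inf_le_right).mk_notMem_zpowers
  · intro q hq h
    have hR : wordLength SB z + 3 * k ≤ phiFun SB (4 * k) := by
      unfold phiFun
      omega
    exact (hL q hq).1 (hinj ((hL q hq).2.1.trans hR) ((hL q hq).2.2.trans hR)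
      (QuotientGroup.eq.2 (QuotientGroup.eq.1 h).1))

theorem depth_le_of_not_isConj_right {A : Type u} [Group A]
    (hC : IsExtensionClosedPseudovariety C) (hB : IsConjugacySeparable C B) {SB : Finset B}
    (hSB : Generates SB) {x y : RestrictedWreath A B} {n : ℕ} (hr : ¬ IsConj x.right y.right)
    (hx : wordLength SB x.right ≤ n) (hy : wordLength SB y.right ≤ n) :
    depth C (conjugatesOf x) y ≤ conjFun C SB n := by
  obtain ⟨N, hN, hs, hi⟩ := exists_index_eq_depth (hB _ _ hr)
  obtain ⟨h1, h2⟩ := exists_separating_right hC hN hs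
  refine (depth_le h1 h2).trans ?_
  rw [Subgroup.index_comap_of_surjective _ SemidirectProduct.rightHom_surjective, hi]
  exact depth_le_conjFun hSB hr hx hy

theorem asympLE_conjFun_of_fg_comm [CommGroup A] (hC : IsExtensionClosedPseudovariety C)
    (hA : IsConjugacySeparable C A) (hB : IsConjugacySeparable C B)
    (hcyc : IsCyclicSubgroupSeparable C B) {SA : Finset A} {SB : Finset B}
    {SG : Finset (RestrictedWreath A B)} (hSA : Generates SA) (hSB : Generates SB)
    (hSG : Generates SG) :
    AsympLE (conjFun C SG) (fun n => max (conjFun C SB n)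
      ((psiFun C SB n * conjFun C SA (psiFun C SB n * n)) ^ (psiFun C SB n ^ 3))) := by
  have hpsi := psiFun_pos hC hSB hB
  cases subsingleton_or_nontrivial B with
  | inl h =>
    have hCB : C B := hC.of_injective (1 : B →* PUnit.{u + 1}) (fun _ _ _ => Subsingleton.elim _ _)
      hC.trivial
    -- For trivial `B` the inequality `n ≤ Ψ(n)` is not available, but the bound for `B ∈ C` applies
    -- with `|B| = 1`.
    obtain ⟨K, hK⟩ := asympLE_conjFun_of_mem hC hA hCB hSA hSG
    refine ⟨K, fun n => (hK n).trans (Nat.mul_le_mul_left _ (le_max_of_le_right ?_))⟩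
    simp only [Nat.card_unique, one_pow, pow_one]
    refine le_trans ?_ (Nat.le_self_pow (Nat.pow_pos (hpsi _)).ne' _)
    exact (conjFun_mono hSA (Nat.le_mul_of_pos_left _ (hpsi _))).trans
      (Nat.le_mul_of_pos_left _ (hpsi _))
  | inr h =>
    obtain ⟨K, hK⟩ := hSG.exists_wreathSizeLE hSA.isLength hSB.isLength
    -- The index bound is `Ψ(4Kn)`; the extra `1` gives room for `K * n + 1` once `n ≥ 1`.
    refine ⟨4 * K + 1, fun n => ?_⟩
    refine le_trans ?_ (Nat.le_mul_of_pos_left _ (by omega))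
    refine conjFun_le (le_max_of_le_left (one_le_conjFun _ _)) fun x y hxy hx hy => ?_
    have hx' := hK n x hx
    have hy' := hK n y hy
    by_cases hr : IsConj x.right y.right
    swap
    · refine le_max_of_le_left ?_
      exact (depth_le_of_not_isConj_right hC hB hSB hr hx'.right hy'.right).trans
        (conjFun_mono hSB (Nat.mul_le_mul_right _ (by omega)))
    have hn : 1 ≤ n := by
      by_contra h0
      have h0 : n = 0 := by omega
      subst h0
      refine hxy ?_
      rw [hSG.eq_one_of_wordLength (Nat.le_zero.1 hx), hSG.eq_one_of_wordLength (Nat.le_zero.1 hy)]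
    refine le_max_of_le_right ?_
    obtain ⟨M, _, D, hM, hMi, hDc, hD, hsep⟩ :=
      exists_quotient_of_isConj_right hC hB hcyc hSA.isLength hSB hx' hy' hr hxy
    have hQ := le_psiFun hC hSB hB ((4 * K + 1) * n)
    have hPQ : psiFun C SB (4 * (K * n)) ≤ psiFun C SB ((4 * K + 1) * n) :=
      psiFun_mono hC hSB hB (by nlinarith)
    set Q := psiFun C SB ((4 * K + 1) * n)
    set P := psiFun C SB (4 * (K * n))
    have hKn : K * n + 1 ≤ (4 * K + 1) * n := by nlinarith [Nat.zero_le (K * n)]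
    have hQ1 : 1 ≤ Q := hpsi _
    have hc1 := one_le_conjFun (C := C) SA (Q * ((4 * K + 1) * n))
    obtain ⟨N, ⟨hn, hN⟩, hNi, hND⟩ := exists_isCoClass_forall hC D
      (fun d N => d ∉ N) (fun _ _ _ hle h hm => h (hle hm))
      (conjFun C SA (Q * ((4 * K + 1) * n))) fun d hd => by
        have hnc : ¬ IsConj (1 : A) d := fun h => (hD d hd).1 (isConj_one_right.1 h)
        obtain ⟨N, hN, hs, hi⟩ := exists_index_eq_depth (hA 1 d hnc)
        refine ⟨N, hN, hi.trans_le (depth_le_conjFun hSA hnc ?_ ((hD d hd).2.trans ?_)), ?_⟩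
        · rw [wordLength_one]
          exact Nat.zero_le _
        -- Elements of `D` have length quadratic in `n`; one linear factor is absorbed by `Ψ`, the
        -- other is the factor `n` in the argument of the function of `A`.
        · have h2 : 2 * (K * n) ≤ Q := by nlinarith [Nat.zero_le (K * n)]
          calc 2 * (K * n * (K * n)) = 2 * (K * n) * (K * n) := by ring
            _ ≤ _ := Nat.mul_le_mul h2 (by omega)
        · simpa using separatedBy_iff.1 hs 1 (by simp [conjugatesOf])
    set X := conjFun C SA (Q * ((4 * K + 1) * n))
    have := hC.finite _ hN
    have := hC.finite _ hM
    refine (depth_conj_le_of_hom hC (wreathMap (QuotientGroup.mk' N) (QuotientGroup.mk' M))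
      (hC.restrictedWreath hN hM) (hsep _ (QuotientGroup.mk' N) fun d hd h =>
        hND d hd ((QuotientGroup.eq_one_iff d).1 h))).trans ?_
    refine card_restrictedWreath_le.trans ?_
    change N.index ^ M.index * M.index ≤ _
    have hMQ := hMi.trans hPQ
    rw [mul_pow, mul_comm]
    refine Nat.mul_le_mul (hMQ.trans (Nat.le_self_pow (Nat.pow_pos hQ1).ne' _)) ?_
    calc N.index ^ M.index ≤ (X ^ (K * n + 1)) ^ Q :=
          (Nat.pow_le_pow_left (hNi.trans (Nat.pow_le_pow_right hc1 hDc)) _).trans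
            (Nat.pow_le_pow_right (Nat.pow_pos hc1) hMQ)
      _ = X ^ ((K * n + 1) * Q) := by rw [pow_mul]
      _ ≤ X ^ (Q ^ 3) := by
          refine Nat.pow_le_pow_right hc1 ?_
          calc (K * n + 1) * Q ≤ Q * Q := Nat.mul_le_mul_right _ (hKn.trans hQ)
            _ = Q ^ 2 := (pow_two Q).symm
            _ ≤ Q ^ 3 := Nat.pow_le_pow_right hQ1 (by norm_num)

theorem asympLE_conjFun_of_finite_comm [CommGroup A] [Finite A]
    (hC : IsExtensionClosedPseudovariety C) (hA : IsConjugacySeparable C A)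
    (hB : IsConjugacySeparable C B) (hcyc : IsCyclicSubgroupSeparable C B) {SB : Finset B}
    {SG : Finset (RestrictedWreath A B)} (hSB : Generates SB) (hSG : Generates SG) :
    AsympLE (conjFun C SG) (fun n => max (conjFun C SB n)
      (psiFun C SB n * 2 ^ psiFun C SB n)) := by
  have hCA : C A := hA.of_finite hC
  cases subsingleton_or_nontrivial B with
  | inl h =>
    have hCB : C B := hC.of_injective (1 : B →* PUnit.{u + 1}) (fun _ _ _ => Subsingleton.elim _ _)
      hC.trivial
    have hCG := hC.restrictedWreath hCA hCB
    have := hC.finite _ hCG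
    refine ⟨Nat.card (RestrictedWreath A B), fun n => ?_⟩
    refine le_trans ?_ (Nat.le_mul_of_pos_right _ (lt_max_of_lt_left (one_le_conjFun _ _)))
    exact conjFun_le Nat.card_pos fun x y hxy _ _ =>
      depth_conj_le_of_hom hC (MonoidHom.id _) hCG hxy
  | inr h =>
    obtain ⟨K, hK⟩ := hSG.exists_wreathSizeLE (isLength_zero (G := A)) hSB.isLength
    let a := Nat.card A
    have ha : 0 < a := Nat.card_pos
    -- The factor `a + 1` pays for the base `|A|`: `a ^ i ≤ 2 ^ (a * i)`, and `mul_psiFun_le` moves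
    -- `a` into the argument of `Ψ`.
    refine ⟨(a + 1) * (4 * K + 1), fun n => ?_⟩
    refine le_trans ?_ (Nat.le_mul_of_pos_left _ (by positivity))
    refine conjFun_le (le_max_of_le_left (one_le_conjFun _ _)) fun x y hxy hx hy => ?_
    have hx' := hK n x hx
    have hy' := hK n y hy
    have hle : (4 * K + 1) * n ≤ (a + 1) * ((4 * K + 1) * n) :=
      Nat.le_mul_of_pos_left _ (by omega)
    rw [mul_assoc]
    by_cases hr : IsConj x.right y.right
    swap
    · refine le_max_of_le_left ?_
      exact (depth_le_of_not_isConj_right hC hB hSB hr hx'.right hy'.right).trans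
        (conjFun_mono hSB ((Nat.mul_le_mul_right _ (by omega)).trans hle))
    have hn : 1 ≤ n := by
      by_contra h0
      have h0 : n = 0 := by omega
      subst h0
      refine hxy ?_
      rw [hSG.eq_one_of_wordLength (Nat.le_zero.1 hx), hSG.eq_one_of_wordLength (Nat.le_zero.1 hy)]
    refine le_max_of_le_right ?_
    obtain ⟨M, _, D, hM, hMi, -, hD, hsep⟩ :=
      exists_quotient_of_isConj_right hC hB hcyc isLength_zero hSB hx' hy' hr hxy
    have := hC.finite _ hM
    -- A finite `C`-conjugacy separable `A` lies in `C`, so only `B` needs to be cut down.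
    refine (depth_conj_le_of_hom hC (wreathMap (MonoidHom.id A) (QuotientGroup.mk' M))
      (hC.restrictedWreath hCA hM) (hsep _ _ fun d hd => (hD d hd).1)).trans ?_
    refine card_restrictedWreath_le.trans ?_
    change a ^ M.index * M.index ≤ _
    have hMi' : M.index ≤ psiFun C SB ((4 * K + 1) * n) :=
      hMi.trans (psiFun_mono hC hSB hB (by nlinarith))
    have hgrow := mul_psiFun_le hC hSB hB a (n := (4 * K + 1) * n) (Nat.mul_pos (by omega) hn)
    rw [mul_comm]
    refine Nat.mul_le_mul (hMi'.trans (psiFun_mono hC hSB hB hle)) ?_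
    calc a ^ M.index ≤ (2 ^ a) ^ M.index := Nat.pow_le_pow_left Nat.lt_two_pow_self.le _
      _ = 2 ^ (a * M.index) := (pow_mul _ _ _).symm
      _ ≤ _ := Nat.pow_le_pow_right (by norm_num) ((Nat.mul_le_mul_left _ hMi').trans hgrow)

end Bounds

theorem theoremB {A B : Type u} [Group A] [Group B] (C : GroupClass.{u})
    (hC : IsExtensionClosedPseudovariety C)
    (hA : IsConjugacySeparable C A) (hB : IsConjugacySeparable C B) :
    -- characterization of `C`-conjugacy separability of the wreath product
    (Nontrivial A →
      (IsConjugacySeparable C (RestrictedWreath A B) ↔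
        (C B ∨ ((∀ x y : A, x * y = y * x) ∧ IsCyclicSubgroupSeparable C B)))) ∧
    -- the bound for `B ∈ C`
    (C B → ∀ (SA : Finset A) (SG : Finset (RestrictedWreath A B)),
      Generates SA → Generates SG →
      AsympLE (conjFun C SG) (fun n => conjFun C SA n ^ (Nat.card B ^ 3))) ∧
    -- the bound for `A` infinite, finitely generated abelian
    ((∀ x y : A, x * y = y * x) → Infinite A → IsCyclicSubgroupSeparable C B →
      ∀ (SA : Finset A) (SB : Finset B) (SG : Finset (RestrictedWreath A B)),
      Generates SA → Generates SB → Generates SG →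
      AsympLE (conjFun C SG) (fun n => max (conjFun C SB n)
        ((psiFun C SB n * conjFun C SA (psiFun C SB n * n)) ^ (psiFun C SB n ^ 3)))) ∧
    -- the bound for `A` finite abelian
    ((∀ x y : A, x * y = y * x) → Finite A → IsCyclicSubgroupSeparable C B →
      ∀ (SB : Finset B) (SG : Finset (RestrictedWreath A B)),
      Generates SB → Generates SG →
      AsympLE (conjFun C SG) (fun n => max (conjFun C SB n)
        (psiFun C SB n * 2 ^ psiFun C SB n))) := by
  refine ⟨fun hnt => ⟨fun h => ?_, ?_⟩, fun hCB SA SG hSA hSG => ?_,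
    fun hcomm _ hcyc SA SB SG hSA hSB hSG => ?_, fun hcomm _ hcyc SB SG hSB hSG => ?_⟩
  · by_cases hCB : C B
    · exact Or.inl hCB
    · have hcomm := h.comm_of_wreath hC hCB
      let _ : CommGroup A := { ‹Group A› with mul_comm := hcomm }
      exact Or.inr ⟨hcomm, IsConjugacySeparable.cyclic_of_wreath (A := A) hC h⟩
  · rintro (hCB | ⟨hcomm, hcyc⟩)
    · exact hA.wreath_of_mem hC hCB
    · let _ : CommGroup A := { ‹Group A› with mul_comm := hcomm }
      exact IsConjugacySeparable.wreath_of_comm (A := A) hC hA hB hcyc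
  · exact asympLE_conjFun_of_mem hC hA hCB hSA hSG
  · let _ : CommGroup A := { ‹Group A› with mul_comm := hcomm }
    exact asympLE_conjFun_of_fg_comm (A := A) hC hA hB hcyc hSA hSB hSG
  · let _ : CommGroup A := { ‹Group A› with mul_comm := hcomm }
    exact asympLE_conjFun_of_finite_comm (A := A) hC hA hB hcyc hSB hSG
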